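/- **Setting.** Datasets $x=(x^{(1)},\dots,x^{(n)})$, $x^{(j)}\in\mathbb R^d$, are neighbouring if they differ in at most one $x^{(j)}$. A randomized mechanism $\mathcal M$ is $\rho$-zCDP if $D_\alpha(\mathcal M(x)\,\|\,\mathcal M(x'))\le\rho\alpha$ for all $\alpha>1$ and all neighbouring $x,x'$, where $D_\alpha$ is the Rényi divergence. *Private quantile.* For $z_1,\dots,z_n\in\mathbb R$, $\mathrm{PrivQuantile}_{\rho}^{R,\tau}(z,q)$ performs $T=\max(0,\lceil\log_2(R/\tau)\rceil)$ steps of binary search on $[-R,R]$; each step compares $\#\{j: z_j\le \text{midpoint}\}+\mathcal N(0,T/(2\rho))$ (fresh noise) with $qn$, continues in the right half if it is smaller than $qn$ and in the left half otherwise. The midpoint of the final interval is returned. For vectors it is applied to each coordinate with budget $\rho/d$. *PLAN* (for $\ell_2$ error; parameters $M$, $k$, $\rho_1,\rho_2,\rho_3$; input $x$ and $\hat\sigma\in\mathbb R^d$; $\hat\Sigma=\mathrm{diag}(\hat\sigma^2)$): let $\tilde\mu=\mathrm{PrivQuantile}_{\rho_1}^{M,1}(x,\tfrac12)$, $y^{(j)}=\hat\Sigma^{-1/4}(x^{(j)}-\tilde\mu)$,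 $C=\mathrm{PrivQuantile}_{\rho_2}^{2M\sqrt d,\,1/M}\big((\|y^{(j)}\|_2)_j,\tfrac{n-k}{n}\big)$, $\eta\sim\mathcal N(0,\tfrac{2C^2}{\rho_3}I)$, and return $$\tilde\mu+\tfrac1n\hat\Sigma^{1/4}\Big(\sum_j\min\{C/\|y^{(j)}\|_2,1\}\,y^{(j)}+\eta\Big).$$ *Distributions.* Let $\mathcal D$ be a distribution on $\mathbb R^d$ with mean $\mu$ and vector $\sigma$ of coordinate standard deviations. For $A>0$, $a\in\mathbb N$, $\mathcal D$ is $\sigma$-well concentrated (with constants $A,a$) if for all $\hat\sigma$ with $$\sigma_i\le\hat\sigma_i<\sigma_i+\|\sigma\|_1/d\quad(1\le i\le d)\tag{$*$}$$ and all $t>1$, each of $\Pr[\sum_i(X_i-\mu_i)^2>t\|\sigma\|_2^2]$ and $\Pr[\sum_i(X_i-\mu_i)^2/\hat\sigma_i>t\|\sigma\|_1]$ is at most $A\exp\!\big(-t/(A(1+\log d+\log t)^a)\big)$. **Theorem.** (1) For every $\rho>0$ and all values of $d,n,M,k,\hat\sigma$, PLAN with $\rho_1=\rho_2=\rho_3=\rho/3$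 is $\rho$-zCDP. (2) There are universal constants $K_1,K_2>0$, $b_1,b_2\in\mathbb N$, and for all $A>0$, $a\in\mathbb N$ constants $K>0$, $b\in\mathbb N$ depending only on $A,a$, such that the following holds. Let $d\ge1$, $\rho>0$, $\beta\in(0,1)$, let $\mathcal D$ be a distribution on $[-M,M]^d$ with $\sigma_i\ge1$ for all $i$ that is $\sigma$-well concentrated with constants $A,a$, and let $\hat\sigma$ satisfy $(*)$. Put $\ell=1+\log d+\log M+\log(1/\beta)$ and $$B=K(\ell+\log n)^b\Big(1+\frac{\|\sigma\|_2}{\sqrt n}+\frac{\|\sigma\|_1}{n\sqrt\rho}\Big).$$ Suppose $n\ge K_1\ell^{b_1}\max(1,\sqrt{d/\rho})$, and run PLAN with $\rho_1=\rho_2=\rho_3=\rho/3$ on $n$ independent samples from $\mathcal D$, with either * $k=\sqrt n$, provided that also $n\ge K_1\ell^{b_1}/\rho$, or * $k=\sqrt n+K_2\ell^{b_2}\sqrt{1/\rho_2}$ (without a further condition on $n$). Then with probability at least $1-\beta$ the $\ell_2$ error of the output is at most $B$; and with probability at least $1-\beta$ over the samples, $\tilde\mu$ and $C$, the expectation of the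 $\ell_2$ error over $\eta$ is at most $B$. -/

import Mathlib

open MeasureTheory ProbabilityTheory

noncomputable section

namespace PLAN

/-! ### Zero-concentrated differential privacy -/

/-- Two datasets of the same size are neighbours if they differ in at most one entry. -/
def Neighbors {n : ℕ} {X : Type*} (x x' : Fin n → X) : Prop :=
  ∃ j : Fin n, ∀ i, i ≠ j → x i = x' i

open Classical in
/-- The `α`-Rényi divergence `(α - 1)⁻¹ log ∫ (dP/dQ)^α dQ` (for `α > 1`),
which is `⊤` when `P` is not absolutely continuous with respect to `Q`. -/
def renyiDiv {Ω : Type*} [MeasurableSpace Ω] (α : ℝ) (P Q : Measure Ω) : EReal :=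
  if P ≪ Q then
    (((α - 1)⁻¹ : ℝ) : EReal) * ENNReal.log (∫⁻ ω, (P.rnDeriv Q ω) ^ α ∂Q)
  else ⊤

/-- A randomized mechanism, given by its output law on every dataset, is `ρ`-zCDP. -/
def IsZCDP {n : ℕ} {X Ω : Type*} [MeasurableSpace Ω]
    (mech : (Fin n → X) → Measure Ω) (ρ : ℝ) : Prop :=
  (∀ x, IsProbabilityMeasure (mech x)) ∧
    ∀ α : ℝ, 1 < α → ∀ x x' : Fin n → X, Neighbors x x' →
      renyiDiv α (mech x) (mech x') ≤ ((ρ * α : ℝ) : EReal)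

/-! ### Private quantiles by noisy binary search -/

/-- Noisy binary search. `cnt t` is the number of data points that are at most `t`, `m` is the
target rank, `s` the standard deviation of the noise on each count and `g` the standard normal
variables that are used. In each step the interval `(l, r)` is halved. -/
def noisySearch (cnt : ℝ → ℝ) (m s : ℝ) : (T : ℕ) → (Fin T → ℝ) → ℝ × ℝ → ℝ × ℝ
  | 0, _, I => I
  | T + 1, g, (l, r) =>
      if cnt ((l + r) / 2) + s * g 0 < m then
        noisySearch cnt m s T (Fin.tail g) ((l + r) / 2, r)
      else
        noisySearch cnt m s T (Fin.tail g) (l, (l + r) / 2)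

/-- The number of `j` with `z j ≤ t`. -/
def countLE {n : ℕ} (z : Fin n → ℝ) (t : ℝ) : ℝ :=
  ((Finset.univ.filter fun j => z j ≤ t).card : ℝ)

/-- The private `q`-quantile of `z 0, …, z (n-1)` over `[-R, R]` with privacy budget `ρ`:
`T` steps of binary search, each spending `ρ / T` on a count of sensitivity `1` (so the noise has
variance `T / (2ρ)`), and then the midpoint of the final interval. -/
def privQuantile {n : ℕ} (R : ℝ) (T : ℕ) (ρ : ℝ) (z : Fin n → ℝ) (q : ℝ) (g : Fin T → ℝ) : ℝ :=
  let I := noisySearch (countLE z) (q * n) (√(T / (2 * ρ))) T g (-R, R)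
  (I.1 + I.2) / 2

/-- The number of halvings of `[-R, R]` after which the midpoint of the current interval is within
`τ` of all points of this interval. -/
def searchSteps (R τ : ℝ) : ℕ := ⌈Real.logb 2 (R / τ)⌉₊

/-! ### The mechanism (for `p = 2`) -/

/-- Steps of the search for the median: accuracy `1` on `[-M, M]`. -/
abbrev stepsMedian (M : ℝ) : ℕ := searchSteps M 1

/-- Range of the search for the clipping radius: bounds the norm of all rescaled vectors. -/
abbrev clipRange (d : ℕ) (M : ℝ) : ℝ := 2 * M * √d

/-- Steps of the search for the clipping radius: accuracy `1 / M` on `[-2M√d, 2M√d]`. -/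
abbrev stepsClip (d : ℕ) (M : ℝ) : ℕ := searchSteps (clipRange d M) (1 / M)

/-- The random source: standard normal variables for the `d` median searches, for the search of
the clipping radius, and for the final additive noise. -/
abbrev Noise (d T₁ T₂ : ℕ) : Type :=
  (Fin d → Fin T₁ → ℝ) × (Fin T₂ → ℝ) × (Fin d → ℝ)

/-- The law of `m` independent standard normal variables. -/
def stdNormal (m : ℕ) : Measure (Fin m → ℝ) := Measure.pi fun _ => gaussianReal 0 1

/-- The law of the random source: all variables are independent and standard normal. -/
def noiseLaw (d T₁ T₂ : ℕ) : Measure (Noise d T₁ T₂) :=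
  (Measure.pi fun _ : Fin d => stdNormal T₁).prod ((stdNormal T₂).prod (stdNormal d))

/-- Private coordinate-wise median, with budget `ρ₁ / d` per coordinate. -/
def roughMean {d n : ℕ} (M ρ₁ : ℝ) (x : Fin n → EuclideanSpace ℝ (Fin d))
    (g : Fin d → Fin (stepsMedian M) → ℝ) : EuclideanSpace ℝ (Fin d) :=
  WithLp.toLp 2 fun i =>
    privQuantile M (stepsMedian M) (ρ₁ / d) (fun j => x j i) (1 / 2) (g i)

/-- Recentering and multiplication by `Σ̂^{-1/4}`, where `Σ̂ = diag(σ̂²)`. -/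
def rescale {d : ℕ} (σhat : Fin d → ℝ) (c x : EuclideanSpace ℝ (Fin d)) :
    EuclideanSpace ℝ (Fin d) :=
  WithLp.toLp 2 fun i => (x i - c i) / √(σhat i)

/-- Multiplication by `Σ̂^{1/4}`. -/
def unscale {d : ℕ} (σhat : Fin d → ℝ) (y : EuclideanSpace ℝ (Fin d)) :
    EuclideanSpace ℝ (Fin d) :=
  WithLp.toLp 2 fun i => √(σhat i) * y i

/-- The private clipping radius: the `(n - k) / n`-quantile of the norms of the `y j`. -/
def clipRadius {d n : ℕ} (M k ρ₂ : ℝ) (y : Fin n → EuclideanSpace ℝ (Fin d))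
    (g : Fin (stepsClip d M) → ℝ) : ℝ :=
  privQuantile (clipRange d M) (stepsClip d M) ρ₂ (fun j => ‖y j‖) ((n - k) / n) g

/-- The output of the mechanism as a function of the data and the random source. -/
def plan {d n : ℕ} (M k ρ₁ ρ₂ ρ₃ : ℝ) (σhat : Fin d → ℝ)
    (x : Fin n → EuclideanSpace ℝ (Fin d)) (ω : Noise d (stepsMedian M) (stepsClip d M)) :
    EuclideanSpace ℝ (Fin d) :=
  let c := roughMean M ρ₁ x ω.1
  let y := fun j => rescale σhat c (x j)
  let C := clipRadius M k ρ₂ y ω.2.1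
  let η : EuclideanSpace ℝ (Fin d) := WithLp.toLp 2 fun i => √(2 * C ^ 2 / ρ₃) * ω.2.2 i
  c + (1 / (n : ℝ)) • unscale σhat ((∑ j, min (C / ‖y j‖) 1 • y j) + η)

/-- The output law of the mechanism on the dataset `x`. -/
def planLaw {d n : ℕ} (M k ρ₁ ρ₂ ρ₃ : ℝ) (σhat : Fin d → ℝ)
    (x : Fin n → EuclideanSpace ℝ (Fin d)) : Measure (EuclideanSpace ℝ (Fin d)) :=
  (noiseLaw d (stepsMedian M) (stepsClip d M)).map (plan M k ρ₁ ρ₂ ρ₃ σhat x)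

/-! ### Input distributions -/

/-- The mean of a distribution over `ℝᵈ`. -/
def mean {d : ℕ} (D : Measure (EuclideanSpace ℝ (Fin d))) : EuclideanSpace ℝ (Fin d) :=
  WithLp.toLp 2 fun i => ∫ x, x i ∂D

/-- The vector `σ` of the standard deviations of the coordinates. -/
def sd {d : ℕ} (D : Measure (EuclideanSpace ℝ (Fin d))) : EuclideanSpace ℝ (Fin d) :=
  WithLp.toLp 2 fun i => √(variance (fun x : EuclideanSpace ℝ (Fin d) => x i) D)

/-- The `ℓ₁` norm. -/
def l1Norm {d : ℕ} (v : EuclideanSpace ℝ (Fin d)) : ℝ := ∑ i, |v i|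

/-- `σ i ≤ σ̂ i < σ i + ‖σ‖₁ / d` for all `i`. -/
def IsSdEstimate {d : ℕ} (σ : EuclideanSpace ℝ (Fin d)) (σhat : Fin d → ℝ) : Prop :=
  ∀ i, σ i ≤ σhat i ∧ σhat i < σ i + l1Norm σ / d

/-- `D` is `σ`-well concentrated, where the tail bound `exp (-Ω̃(t))` is
`A exp (-t / (A (1 + log d + log t)^a))`. -/
def WellConcentrated (A : ℝ) (a : ℕ) {d : ℕ} (D : Measure (EuclideanSpace ℝ (Fin d))) : Prop :=
  ∀ σhat : Fin d → ℝ, IsSdEstimate (sd D) σhat → ∀ t : ℝ, 1 < t →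
    D.real {x | t * ‖sd D‖ ^ 2 < ∑ i, (x i - mean D i) ^ 2}
        ≤ A * Real.exp (-(t / (A * (1 + Real.log d + Real.log t) ^ a))) ∧
    D.real {x | t * l1Norm (sd D) < ∑ i, (x i - mean D i) ^ 2 / σhat i}
        ≤ A * Real.exp (-(t / (A * (1 + Real.log d + Real.log t) ^ a)))

/-! ### Accuracy -/

/-- The mechanism run on `n` independent samples from `D` has `ℓ₂` error at most `B` with
probability at least `1 - β`. Moreover, its expected `ℓ₂` error over the final Gaussian noise is
at most `B` with probability at least `1 - β` over the samples and the private quantiles. -/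
def PlanAccurate {d : ℕ} (n : ℕ) (M k ρ₁ ρ₂ ρ₃ : ℝ) (σhat : Fin d → ℝ)
    (D : Measure (EuclideanSpace ℝ (Fin d))) (B β : ℝ) : Prop :=
  ((Measure.pi fun _ : Fin n => D).prod (noiseLaw d (stepsMedian M) (stepsClip d M)))
      {p | B < ‖plan M k ρ₁ ρ₂ ρ₃ σhat p.1 p.2 - mean D‖} ≤ ENNReal.ofReal β ∧
  ((Measure.pi fun _ : Fin n => D).prod (noiseLaw d (stepsMedian M) (stepsClip d M)))
      {p | ENNReal.ofReal B <
        ∫⁻ g, ‖plan M k ρ₁ ρ₂ ρ₃ σhat p.1 (p.2.1, p.2.2.1, g) - mean D‖ₑ ∂(stdNormal d)}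
    ≤ ENNReal.ofReal β

/-- The quantity whose powers `Õ` and `Ω̃` hide, apart from the dependence on `n`. -/
def logFactor (d : ℕ) (M β : ℝ) : ℝ := 1 + Real.log d + Real.log M + Real.log (1 / β)

end PLAN

end

open scoped ENNReal

namespace PLAN

section

/-! ### Rényi bounds through Hölder-type inequalities -/

/-! Privacy. The bound `D_α(P ‖ Q) ≤ ε α` says that `dP/dQ` has norm at most `exp ((α - 1) ε)` in
`L^α(Q)`. By duality this is an inequality for all nonnegative test functions, `HolderDom`. In this
form post-processing is a change of variables, and adaptive composition (`HolderDom.comp`) consists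
of two applications in a row, whose budgets add up. Densities are needed only for a shift by `δ` of
one standard normal variable, which costs `δ² / 2` (`holderDom_gaussianReal`), and for the return to
Rényi divergence (`HolderDom.renyiDiv_le`). PLAN is an adaptive composition of noisy counts of
sensitivity `1` and of a noisy clipped sum of sensitivity `2|C|`; the variances are chosen such that
the three stages cost `ρ₁`, `ρ₂` and `ρ₃`.

Utility. The error is bounded deterministically for a typical sample and noise variables bounded by
a polylogarithmic `u` (`norm_plan_sub_le`). There the private median lies within `5 σ i` of the mean
in every coordinate, so all rescaled vectors have norm `O(√(t ‖σ‖₁))`. Hence `C² = O(t ‖σ‖₁)`, and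
at most `k + N` vectors are clipped by more than the search accuracy, where `N` bounds the noise of
a count. Apart from a bounded search error, three terms remain: the sampling error of order `‖σ‖₂ /
√n`; the bias `(k + N) √t ‖σ‖₂ / n`, which for `k ≈ √n` has the same order up to a part of size
`‖σ‖₂ / (n √ρ) ≤ ‖σ‖₁ / (n √ρ)`; and the final noise. In the last term the scaling by `Σ̂^{1/4}`
balances the two factors: the radius and the norm of the rescaled noise both contribute `√‖σ‖₁`,
which gives `‖σ‖₁ / (n √ρ)`.

Typicality (`pi_not_typicalSample_le`) follows from union bounds over the tail assumption at a
polylogarithmic scale `t` (`exists_concentration_scale`), from Chebyshev and Chernoff bounds for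
coordinatewise outliers, and from a symmetrization argument for the sample mean
(`sum_sub_mean_tail_le`). -/

/-- `P` is dominated by `Q` in the sense of Hölder's inequality. This is the dual form of the
bound `D_α(P ‖ Q) ≤ ε α`. -/
def HolderDom {Ω : Type*} [MeasurableSpace Ω] (α ε : ℝ) (P Q : Measure Ω) : Prop :=
  ∀ f : Ω → ℝ≥0∞, Measurable f → ∫⁻ ω, f ω ∂P ≤
    ENNReal.ofReal (Real.exp ((α - 1) * ε)) *
      (∫⁻ ω, f ω ^ (α / (α - 1)) ∂Q) ^ ((α - 1) / α)

variable {Ω Ω' Y Z : Type*} [MeasurableSpace Ω] [MeasurableSpace Ω'] [MeasurableSpace Y]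
  [MeasurableSpace Z] {α ε ε₁ ε₂ : ℝ}

theorem HolderDom.mono (hα : 1 < α) {P Q : Measure Ω} (h : HolderDom α ε₁ P Q) (hε : ε₁ ≤ ε₂) :
    HolderDom α ε₂ P Q := by
  intro f hf
  refine (h f hf).trans ?_
  gcongr

theorem HolderDom.map {P Q : Measure Ω} (h : HolderDom α ε P Q) {F : Ω → Y} (hF : Measurable F) :
    HolderDom α ε (P.map F) (Q.map F) := by
  intro f hf
  rw [lintegral_map hf hF, lintegral_map (hf.pow_const _) hF]
  exact h _ (hf.comp hF)

/-- Adaptive composition. -/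
theorem HolderDom.comp (hα : 1 < α) {μ : Measure Ω} {ν : Measure Ω'} [SFinite ν]
    {A A' : Ω → Y} {B B' : Y → Ω' → Z} (hA : Measurable A) (hA' : Measurable A')
    (hB : Measurable (Function.uncurry B)) (hB' : Measurable (Function.uncurry B'))
    (h₁ : HolderDom α ε₁ (μ.map A) (μ.map A'))
    (h₂ : ∀ y, HolderDom α ε₂ (ν.map (B y)) (ν.map (B' y))) :
    HolderDom α (ε₁ + ε₂) ((μ.prod ν).map fun w => B (A w.1) w.2)
      ((μ.prod ν).map fun w => B' (A' w.1) w.2) := by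
  intro f hf
  have hBA : Measurable fun w : Ω × Ω' => B (A w.1) w.2 :=
    hB.comp ((hA.comp measurable_fst).prodMk measurable_snd)
  have hBA' : Measurable fun w : Ω × Ω' => B' (A' w.1) w.2 :=
    hB'.comp ((hA'.comp measurable_fst).prodMk measurable_snd)
  have hα0 : 0 < α := by linarith
  have hα1 : 0 < α - 1 := by linarith
  set p := α / (α - 1) with hp
  set q := (α - 1) / α with hq
  have hqp : q * p = 1 := by rw [hp, hq]; field_simp
  rw [lintegral_map hf hBA, lintegral_map (hf.pow_const _) hBA',
    lintegral_prod (fun w => f (B (A w.1) w.2)) (hf.comp hBA).aemeasurable,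
    lintegral_prod (fun w => f (B' (A' w.1) w.2) ^ p)
      ((hf.comp hBA').pow_const _).aemeasurable]
  set h : Y → ℝ≥0∞ := fun y => ∫⁻ w, f (B' y w) ^ p ∂ν with hh
  have hhm : Measurable h := ((hf.comp hB').pow_const p).lintegral_prod_right'
  have hBy : ∀ y, Measurable (B y) := fun y => hB.comp measurable_prodMk_left
  have hBy' : ∀ y, Measurable (B' y) := fun y => hB'.comp measurable_prodMk_left
  have key : ∀ y, ∫⁻ w, f (B y w) ∂ν ≤
      ENNReal.ofReal (Real.exp ((α - 1) * ε₂)) * h y ^ q := by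
    intro y
    have := h₂ y f hf
    rwa [lintegral_map hf (hBy y), lintegral_map (hf.pow_const _) (hBy' y)] at this
  -- The inner stage leaves `h ^ q`. Since `q * p = 1`, using it as the test function of the outer
  -- stage restores `h`, which is the full inner integral.
  have k1 := h₁ (fun y => h y ^ q) (hhm.pow_const q)
  rw [lintegral_map (hhm.pow_const q) hA, lintegral_map ((hhm.pow_const q).pow_const _) hA'] at k1
  simp only [← ENNReal.rpow_mul, ← hp, ← hq, hqp, ENNReal.rpow_one] at k1
  calc ∫⁻ x, ∫⁻ y, f (B (A x) y) ∂ν ∂μ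
      ≤ ∫⁻ x, ENNReal.ofReal (Real.exp ((α - 1) * ε₂)) * h (A x) ^ q ∂μ :=
        lintegral_mono fun x => key (A x)
    _ = ENNReal.ofReal (Real.exp ((α - 1) * ε₂)) * ∫⁻ x, h (A x) ^ q ∂μ :=
        lintegral_const_mul _ ((hhm.comp hA).pow_const q)
    _ ≤ ENNReal.ofReal (Real.exp ((α - 1) * ε₂)) *
          (ENNReal.ofReal (Real.exp ((α - 1) * ε₁)) * (∫⁻ x, h (A' x) ∂μ) ^ q) := by gcongr
    _ = _ := by
        rw [← mul_assoc, ← ENNReal.ofReal_mul (Real.exp_nonneg _), ← Real.exp_add]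
        congr 3
        ring

/-- Hölder's inequality against the constant `1`, whose norm is `1` for a probability measure. -/
theorem HolderDom.refl (hα : 1 < α) (P : Measure Ω) [IsProbabilityMeasure P] :
    HolderDom α 0 P P := by
  intro f hf
  have hc := (Real.HolderConjugate.conjExponent hα)
  have := ENNReal.lintegral_mul_le_Lp_mul_Lq P hc.symm hf.aemeasurable
    (aemeasurable_const (b := (1 : ℝ≥0∞)))
  simp only [Pi.mul_apply, mul_one, ENNReal.one_rpow, lintegral_const, measure_univ] at this
  simpa [Real.conjExponent] using this

/-- A Hölder-type bound implies absolute continuity. -/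
theorem HolderDom.absolutelyContinuous (hα : 1 < α) {P Q : Measure Ω} (h : HolderDom α ε P Q) :
    P ≪ Q := by
  have hα0 : 0 < α := by linarith
  have hα1 : 0 < α - 1 := by linarith
  refine Measure.AbsolutelyContinuous.mk fun s hs h0 => ?_
  have := h (s.indicator 1) (measurable_one.indicator hs)
  have e : (fun ω => (s.indicator (1 : Ω → ℝ≥0∞) ω) ^ (α / (α - 1))) = s.indicator 1 := by
    ext ω
    by_cases hω : ω ∈ s <;> simp [hω, hα0, hα1]
  rw [e, lintegral_indicator_one hs, lintegral_indicator_one hs, h0,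
    ENNReal.zero_rpow_of_pos (by positivity), mul_zero] at this
  simpa using this

theorem HolderDom.renyiDiv_le (hα : 1 < α) {P Q : Measure Ω} [IsFiniteMeasure P]
    [IsFiniteMeasure Q] (h : HolderDom α ε P Q) : renyiDiv α P Q ≤ ((ε * α : ℝ) : EReal) := by
  have hα0 : 0 < α := by linarith
  have hα1 : 0 < α - 1 := by linarith
  have hac := h.absolutelyContinuous hα
  set K := ENNReal.ofReal (Real.exp ((α - 1) * ε)) with hK
  set r := P.rnDeriv Q with hr
  have hrm : Measurable r := Measure.measurable_rnDeriv P Q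
  -- The extremal test function in Hölder's inequality is `r ^ (α - 1)`. Truncating `r` makes the
  -- integral `I` finite, so that `I ≤ K * I ^ ((α - 1) / α)` may be divided by the power of `I`;
  -- monotone convergence then removes the truncation.
  have trunc : ∀ N : ℕ, ∫⁻ ω, (min (r ω) N) ^ α ∂Q ≤ K ^ α := by
    intro N
    set I := ∫⁻ ω, (min (r ω) N) ^ α ∂Q with hI
    have hIfin : I ≠ ∞ := by
      refine ((lintegral_mono (g := fun _ => (N : ℝ≥0∞) ^ α) fun ω => ?_).trans_lt ?_).ne
      · exact ENNReal.rpow_le_rpow (min_le_right _ _) hα0.le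
      · rw [lintegral_const]
        exact ENNReal.mul_lt_top (ENNReal.rpow_lt_top_of_nonneg hα0.le (by simp))
          (measure_lt_top _ _)
    have hm : Measurable fun ω => (min (r ω) (N : ℝ≥0∞)) ^ (α - 1) :=
      (hrm.min measurable_const).pow_const _
    have h1 := h _ hm
    rw [← lintegral_rnDeriv_mul hac hm.aemeasurable] at h1
    have e : (fun ω => ((min (r ω) (N : ℝ≥0∞)) ^ (α - 1)) ^ (α / (α - 1))) =
        fun ω => (min (r ω) (N : ℝ≥0∞)) ^ α := by
      ext ω
      rw [← ENNReal.rpow_mul]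
      congr 1
      field_simp
    rw [e, ← hI, ← hK] at h1
    have h2 : I ≤ K * I ^ ((α - 1) / α) := by
      refine le_trans (lintegral_mono fun ω => ?_) h1
      calc (min (r ω) (N : ℝ≥0∞)) ^ α
          = (min (r ω) (N : ℝ≥0∞)) ^ (1 : ℝ) * (min (r ω) (N : ℝ≥0∞)) ^ (α - 1) := by
            rw [← ENNReal.rpow_add_of_nonneg _ _ zero_le_one hα1.le]
            congr 1; ring
        _ ≤ _ := by
            rw [ENNReal.rpow_one]
            gcongr
            exact min_le_left _ _
    by_cases hI0 : I = 0
    · rw [hI0]; exact zero_le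
    have h3 : I ^ (1 / α) ≤ K := by
      have hJ0 : I ^ ((α - 1) / α) ≠ 0 := by
        simp only [ne_eq, ENNReal.rpow_eq_zero_iff, not_or, not_and]
        exact ⟨fun h => absurd h hI0, fun h => absurd h hIfin⟩
      have hJt : I ^ ((α - 1) / α) ≠ ∞ :=
        ENNReal.rpow_ne_top_of_nonneg (by positivity) hIfin
      rw [← ENNReal.mul_le_mul_iff_left hJ0 hJt, ← ENNReal.rpow_add _ _ hI0 hIfin]
      have : 1 / α + (α - 1) / α = 1 := by field_simp; ring
      rwa [this, ENNReal.rpow_one]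
    calc I = (I ^ (1 / α)) ^ α := by
            rw [← ENNReal.rpow_mul, one_div, inv_mul_cancel₀ hα0.ne', ENNReal.rpow_one]
      _ ≤ K ^ α := ENNReal.rpow_le_rpow h3 hα0.le
  have hlim : ∫⁻ ω, r ω ^ α ∂Q ≤ K ^ α := by
    have hsup : ∀ ω, r ω ^ α = ⨆ N : ℕ, (min (r ω) (N : ℝ≥0∞)) ^ α := by
      intro ω
      have h1 : (⨆ N : ℕ, min (r ω) (N : ℝ≥0∞)) = r ω := by
        rw [← inf_iSup_eq, ENNReal.iSup_natCast, inf_top_eq]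
      conv_lhs => rw [← h1]
      exact (ENNReal.orderIsoRpow α hα0).map_iSup _
    simp_rw [hsup]
    rw [lintegral_iSup]
    · exact iSup_le trunc
    · exact fun N => (hrm.min measurable_const).pow_const _
    · intro N N' hN ω
      exact ENNReal.rpow_le_rpow (min_le_min_left _ (by exact_mod_cast hN)) hα0.le
  have hlog : ENNReal.log (∫⁻ ω, r ω ^ α ∂Q) ≤ (((α - 1) * (ε * α) : ℝ) : EReal) := by
    refine (ENNReal.log_le_log_iff.2 hlim).trans_eq ?_
    rw [hK, ENNReal.ofReal_rpow_of_pos (Real.exp_pos _), ENNReal.log_ofReal, ← Real.exp_mul,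
      if_neg (not_le.2 (Real.exp_pos _)), Real.log_exp]
    congr 1; ring
  rw [renyiDiv, if_pos hac]
  calc (((α - 1)⁻¹ : ℝ) : EReal) * ENNReal.log (∫⁻ ω, r ω ^ α ∂Q)
      ≤ (((α - 1)⁻¹ : ℝ) : EReal) * (((α - 1) * (ε * α) : ℝ) : EReal) :=
        mul_le_mul_of_nonneg_left hlog (by exact_mod_cast (inv_pos.2 hα1).le)
    _ = ((ε * α : ℝ) : EReal) := by
        rw [← EReal.coe_mul, ← mul_assoc, inv_mul_cancel₀ hα1.ne', one_mul]

/-- Products of Hölder-dominated laws. -/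
theorem HolderDom.pi (hα : 1 < α) : ∀ {d : ℕ} {ε : Fin d → ℝ} {μ : Fin d → Measure Ω}
    [∀ i, IsProbabilityMeasure (μ i)] {A A' : Fin d → Ω → Y} (_ : ∀ i, Measurable (A i))
    (_ : ∀ i, Measurable (A' i)) (_ : ∀ i, HolderDom α (ε i) ((μ i).map (A i)) ((μ i).map (A' i))),
    HolderDom α (∑ i, ε i) ((Measure.pi μ).map fun g i => A i (g i))
      ((Measure.pi μ).map fun g i => A' i (g i))
  | 0, ε, μ, _, A, A', _, _, _ => by
    have : (fun (g : Fin 0 → Ω) i => A i (g i)) = fun g i => A' i (g i) := by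
      ext g i; exact i.elim0
    rw [this, Finset.univ_eq_empty, Finset.sum_empty]
    have : IsProbabilityMeasure ((Measure.pi μ).map fun g i => A' i (g i)) :=
      Measure.isProbabilityMeasure_map
        (measurable_pi_lambda _ fun i => i.elim0).aemeasurable
    exact HolderDom.refl hα _
  | d + 1, ε, μ, _, A, A', hA, hA', h => by
    have hmp := measurePreserving_piFinSuccAbove μ 0
    have ih := HolderDom.pi hα (fun i : Fin d => hA i.succ) (fun i => hA' i.succ)
      (fun i => h i.succ)
    have hcons : Measurable fun w : Y × (Fin d → Y) => (Fin.cons w.1 w.2 : Fin (d + 1) → Y) := by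
      refine measurable_pi_lambda _ fun i => ?_
      refine Fin.cases ?_ (fun i => ?_) i
      · simpa using measurable_fst
      · exact (measurable_pi_apply i).comp measurable_snd
    have hm : ∀ {A : Fin (d + 1) → Ω → Y}, (∀ i, Measurable (A i)) →
        Measurable (fun (w : Fin d → Ω) i => A i.succ (w i)) := fun hA =>
      measurable_pi_lambda _ fun i => (hA i.succ).comp (measurable_pi_apply i)
    have hB : ∀ {A : Fin (d + 1) → Ω → Y}, (∀ i, Measurable (A i)) →
        Measurable (Function.uncurry fun (y : Y) (w : Fin d → Ω) =>
          (Fin.cons y (fun i => A i.succ (w i)) : Fin (d + 1) → Y)) := fun {A} hA =>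
      hcons.comp (measurable_fst.prodMk ((hm hA).comp measurable_snd))
    -- A product is a non-adaptive composition: the second stage prepends the first output `y` to an
    -- independent tail.
    have key := HolderDom.comp hα (ν := Measure.pi fun i : Fin d => μ i.succ) (hA 0) (hA' 0)
      (hB hA) (hB hA') (h 0) (ε₂ := ∑ i : Fin d, ε i.succ) (fun y => by
        have hy : Measurable fun w : Fin d → Y => (Fin.cons y w : Fin (d + 1) → Y) :=
          hcons.comp measurable_prodMk_left
        have := ih.map (F := fun w => (Fin.cons y w : Fin (d + 1) → Y))
          hy
        rwa [Measure.map_map hy (hm hA), Measure.map_map hy (hm hA')] at this)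
    rw [Fin.sum_univ_succ]
    have tr : ∀ {A : Fin (d + 1) → Ω → Y}, (∀ i, Measurable (A i)) →
        (Measure.pi μ).map (fun g i => A i (g i)) =
        ((μ 0).prod (Measure.pi fun i : Fin d => μ i.succ)).map fun w =>
          (Fin.cons (A 0 w.1) (fun i => A i.succ (w.2 i)) : Fin (d + 1) → Y) := by
      intro A hA
      have := hmp.map_eq
      simp only [Fin.succAbove_zero] at this
      rw [← this, Measure.map_map _ (MeasurableEquiv.measurable _)]
      · congr 1
        ext g i
        refine Fin.cases ?_ (fun i => ?_) i
        · simp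
        · simp [Fin.tail]
      · exact (hB hA).comp (((hA 0).comp measurable_fst).prodMk measurable_snd)
    rw [tr hA, tr hA']
    exact key

/-! ### Shifts of Gaussian noise -/

theorem lintegral_exp_mul_gaussianReal (c : ℝ) :
    ∫⁻ x, ENNReal.ofReal (Real.exp (c * x)) ∂(gaussianReal 0 1) =
      ENNReal.ofReal (Real.exp (c ^ 2 / 2)) := by
  rw [← ofReal_integral_eq_lintegral_ofReal (integrable_exp_mul_gaussianReal c)
    (ae_of_all _ fun _ => (Real.exp_pos _).le)]
  congr 1
  have := congrFun (mgf_id_gaussianReal (μ := 0) (v := 1)) c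
  simpa [mgf] using this

theorem gaussianReal_eq_withDensity (δ : ℝ) : gaussianReal δ 1 =
    (gaussianReal 0 1).withDensity fun x => ENNReal.ofReal (Real.exp (δ * x - δ ^ 2 / 2)) := by
  rw [gaussianReal_of_var_ne_zero _ one_ne_zero, gaussianReal_of_var_ne_zero _ one_ne_zero,
    ← withDensity_mul _ (measurable_gaussianPDF 0 1) (by fun_prop)]
  congr 1
  ext x
  simp only [gaussianPDF, Pi.mul_apply, gaussianPDFReal]
  rw [← ENNReal.ofReal_mul (by positivity), mul_assoc (√_)⁻¹, ← Real.exp_add]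
  congr 3
  simp only [NNReal.coe_one]
  ring

/-- The shifted law has density `exp (δ x - δ² / 2)`. Its `α`-th moment is `exp (α² δ² / 2 - α δ² /
2)`, and the `α`-th root of this is `exp ((α - 1) δ² / 2)`. -/
theorem holderDom_gaussianReal (hα : 1 < α) (δ : ℝ) :
    HolderDom α (δ ^ 2 / 2) ((gaussianReal 0 1).map fun x => x + δ) (gaussianReal 0 1) := by
  have hα0 : 0 < α := by linarith
  intro f hf
  rw [gaussianReal_map_add_const, zero_add, gaussianReal_eq_withDensity,
    lintegral_withDensity_eq_lintegral_mul _ (by fun_prop) hf]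
  have := ENNReal.lintegral_mul_le_Lp_mul_Lq (gaussianReal 0 1)
    (Real.HolderConjugate.conjExponent hα)
    (f := fun x => ENNReal.ofReal (Real.exp (δ * x - δ ^ 2 / 2)))
    (by fun_prop) hf.aemeasurable
  refine this.trans_eq ?_
  simp only [Real.conjExponent, one_div_div]
  congr 1
  have e : (fun x => ENNReal.ofReal (Real.exp (δ * x - δ ^ 2 / 2)) ^ α) = fun x =>
      ENNReal.ofReal (Real.exp (-(α * δ ^ 2 / 2))) *
        ENNReal.ofReal (Real.exp ((α * δ) * x)) := by
    ext x
    rw [ENNReal.ofReal_rpow_of_pos (Real.exp_pos _), ← Real.exp_mul,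
      ← ENNReal.ofReal_mul (Real.exp_nonneg _), ← Real.exp_add]
    congr 2; ring
  rw [e, lintegral_const_mul _ (by fun_prop), lintegral_exp_mul_gaussianReal,
    ← ENNReal.ofReal_mul (Real.exp_nonneg _), ← Real.exp_add,
    ENNReal.ofReal_rpow_of_pos (Real.exp_pos _), ← Real.exp_mul]
  congr 2
  field_simp
  ring

/-- A measurable function of Gaussian noise, and the same function of the shifted noise. -/
theorem holderDom_gaussianReal_comp (hα : 1 < α) (δ : ℝ) {F : ℝ → Y} (hF : Measurable F) :
    HolderDom α (δ ^ 2 / 2) ((gaussianReal 0 1).map fun x => F (x + δ))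
      ((gaussianReal 0 1).map F) := by
  have := (holderDom_gaussianReal hα δ).map hF
  rwa [Measure.map_map hF (by fun_prop)] at this

instance (m : ℕ) : IsProbabilityMeasure (stdNormal m) := by
  unfold stdNormal; infer_instance

instance (d T₁ T₂ : ℕ) : IsProbabilityMeasure (noiseLaw d T₁ T₂) := by
  unfold noiseLaw; infer_instance

theorem holderDom_stdNormal_comp (hα : 1 < α) {m : ℕ} (δ : Fin m → ℝ) {F : (Fin m → ℝ) → Y}
    (hF : Measurable F) :
    HolderDom α (∑ i, δ i ^ 2 / 2) ((stdNormal m).map fun x => F fun i => x i + δ i)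
      ((stdNormal m).map F) := by
  have := (HolderDom.pi hα (μ := fun _ : Fin m => gaussianReal 0 1)
    (A := fun i x => x + δ i) (A' := fun _ x => x) (fun i => by fun_prop) (fun i => by fun_prop)
    (fun i => holderDom_gaussianReal_comp hα (δ i) measurable_id)).map hF
  rwa [Measure.map_map hF (by fun_prop), Measure.map_map hF (by fun_prop)] at this

end

section

/-! ### Privacy of the noisy binary search -/

/-- One step of the noisy binary search. -/
noncomputable def searchStep (cnt : ℝ → ℝ) (m s u : ℝ) (I : ℝ × ℝ) : ℝ × ℝ :=
  if cnt ((I.1 + I.2) / 2) + s * u < m then ((I.1 + I.2) / 2, I.2) else (I.1, (I.1 + I.2) / 2)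

theorem noisySearch_succ (cnt : ℝ → ℝ) (m s : ℝ) (T : ℕ) (g : Fin (T + 1) → ℝ) (I : ℝ × ℝ) :
    noisySearch cnt m s (T + 1) g I =
      noisySearch cnt m s T (Fin.tail g) (searchStep cnt m s (g 0) I) := by
  obtain ⟨l, r⟩ := I
  simp only [noisySearch, searchStep]
  split_ifs <;> rfl

theorem measurable_searchStep {P : Type*} [MeasurableSpace P] {cnt : P → ℝ → ℝ}
    (h : Measurable (Function.uncurry cnt)) (m s : ℝ) :
    Measurable fun w : P × ℝ × (ℝ × ℝ) => searchStep (cnt w.1) m s w.2.1 w.2.2 := by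
  unfold searchStep
  have hc : Measurable fun w : P × ℝ × (ℝ × ℝ) => cnt w.1 ((w.2.2.1 + w.2.2.2) / 2) :=
    h.comp (measurable_fst.prodMk (by fun_prop))
  refine Measurable.ite (measurableSet_lt (hc.add (by fun_prop)) measurable_const) ?_ ?_ <;>
    fun_prop

theorem measurable_noisySearch {P : Type*} [MeasurableSpace P] {cnt : P → ℝ → ℝ}
    (h : Measurable (Function.uncurry cnt)) (m s : ℝ) : ∀ T : ℕ,
    Measurable fun w : P × (Fin T → ℝ) × (ℝ × ℝ) => noisySearch (cnt w.1) m s T w.2.1 w.2.2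
  | 0 => (measurable_snd.comp measurable_snd : Measurable (Prod.snd ∘ Prod.snd))
  | T + 1 => by
    simp only [noisySearch_succ]
    refine (measurable_noisySearch h m s T).comp
      (measurable_fst.prodMk (Measurable.prodMk ?_ ?_))
    · exact measurable_pi_lambda _ fun i =>
        (measurable_pi_apply i.succ).comp (measurable_fst.comp measurable_snd)
    · exact (measurable_searchStep h m s).comp
        (f := fun w : P × (Fin (T + 1) → ℝ) × (ℝ × ℝ) => (w.1, w.2.1 0, w.2.2)) (by fun_prop)

theorem measurable_noisySearch_of_const {cnt : ℝ → ℝ} (h : Measurable cnt) (m s : ℝ) (T : ℕ) :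
    Measurable (Function.uncurry fun (I : ℝ × ℝ) (g : Fin T → ℝ) => noisySearch cnt m s T g I) :=
  (measurable_noisySearch (P := Unit) (cnt := fun _ => cnt) (h.comp measurable_snd) m s T).comp
    (f := fun w : (ℝ × ℝ) × (Fin T → ℝ) => ((), w.2, w.1)) (by fun_prop)

variable {Y : Type*} [MeasurableSpace Y] {α : ℝ}

theorem stdNormal_succ_map (T : ℕ) {G : ℝ → (Fin T → ℝ) → Y}
    (hG : Measurable (Function.uncurry G)) :
    (stdNormal (T + 1)).map (fun g => G (g 0) (Fin.tail g)) =
      ((gaussianReal 0 1).prod (stdNormal T)).map fun w => G w.1 w.2 := by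
  have := (measurePreserving_piFinSuccAbove (fun _ : Fin (T + 1) => gaussianReal 0 1) 0).map_eq
  unfold stdNormal
  have h2 := Measure.map_map (μ := Measure.pi fun _ : Fin (T + 1) => gaussianReal 0 1) hG
    (MeasurableEquiv.measurable (MeasurableEquiv.piFinSuccAbove (fun _ : Fin (T + 1) => ℝ) 0))
  rw [this] at h2
  exact h2.symm

/-- Replacing `cnt` by `cnt'` in one comparison amounts to shifting its normal variable by at most
`1 / s`, at cost `1 / (2 s²)`. The remaining search depends on the past only through the current
interval, so composition applies by induction. -/
theorem holderDom_noisySearch (hα : 1 < α) {cnt cnt' : ℝ → ℝ} (hc : Measurable cnt)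
    (hc' : Measurable cnt') (hd : ∀ t, |cnt t - cnt' t| ≤ 1) (m : ℝ) {s : ℝ} (hs : 0 < s) :
    ∀ (T : ℕ) (I : ℝ × ℝ), HolderDom α (T * (1 / (2 * s ^ 2)))
      ((stdNormal T).map fun g => noisySearch cnt m s T g I)
      ((stdNormal T).map fun g => noisySearch cnt' m s T g I)
  | 0, I => by
    simp only [noisySearch, CharP.cast_eq_zero, zero_mul]
    have : IsProbabilityMeasure ((stdNormal 0).map fun _ => I) :=
      Measure.isProbabilityMeasure_map aemeasurable_const
    exact HolderDom.refl hα _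
  | T + 1, I => by
    have hstep : ∀ {c : ℝ → ℝ}, Measurable c → Measurable fun u => searchStep c m s u I :=
      fun {c} hc => (measurable_searchStep (P := Unit) (cnt := fun _ => c)
        (hc.comp measurable_snd) m s).comp
        (f := fun u : ℝ => ((), u, I)) (by fun_prop)
    have hsearch : ∀ {c : ℝ → ℝ}, Measurable c →
        Measurable (Function.uncurry fun (I : ℝ × ℝ) (g : Fin T → ℝ) => noisySearch c m s T g I) :=
      fun {c} hc => measurable_noisySearch_of_const hc m s T
    simp only [noisySearch_succ]
    have h₁ : HolderDom α (1 / (2 * s ^ 2))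
        ((gaussianReal 0 1).map fun u => searchStep cnt m s u I)
        ((gaussianReal 0 1).map fun u => searchStep cnt' m s u I) := by
      set δ := (cnt ((I.1 + I.2) / 2) - cnt' ((I.1 + I.2) / 2)) / s with hδ
      have e : (fun u => searchStep cnt m s u I) = fun u => searchStep cnt' m s (u + δ) I := by
        ext1 u
        have : cnt ((I.1 + I.2) / 2) + s * u = cnt' ((I.1 + I.2) / 2) + s * (u + δ) := by
          rw [hδ]; field_simp; ring
        simp only [searchStep, this]
      rw [e]
      refine (holderDom_gaussianReal_comp hα δ (hstep hc')).mono hα ?_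
      have h1 : (cnt ((I.1 + I.2) / 2) - cnt' ((I.1 + I.2) / 2)) ^ 2 ≤ 1 := by
        rw [sq_le_one_iff_abs_le_one]; exact hd _
      rw [hδ, div_pow, div_div, mul_comm]
      gcongr
    have key := HolderDom.comp hα (hstep hc) (hstep hc') (hsearch hc) (hsearch hc') h₁
      (fun J => holderDom_noisySearch hα hc hc' hd m hs T J)
    have tr : ∀ {c : ℝ → ℝ}, Measurable c →
        (stdNormal (T + 1)).map
          (fun g => noisySearch c m s T (Fin.tail g) (searchStep c m s (g 0) I)) =
        ((gaussianReal 0 1).prod (stdNormal T)).map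
          (fun w => noisySearch c m s T w.2 (searchStep c m s w.1 I)) := fun {c} hc =>
      stdNormal_succ_map T (G := fun u g => noisySearch c m s T g (searchStep c m s u I))
        ((hsearch hc).comp (((hstep hc).comp measurable_fst).prodMk measurable_snd))
    rw [tr hc, tr hc']
    convert key using 1
    push_cast; ring

theorem measurable_countLE {P : Type*} [MeasurableSpace P] {n : ℕ} {z : P → Fin n → ℝ}
    (hz : ∀ j, Measurable fun w => z w j) :
    Measurable (Function.uncurry fun (w : P) (t : ℝ) => countLE (z w) t) := by
  have : (Function.uncurry fun (w : P) (t : ℝ) => countLE (z w) t) =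
      fun w => ∑ j, if z w.1 j ≤ w.2 then (1 : ℝ) else 0 := by
    ext w
    simp [Function.uncurry, countLE]
  rw [this]
  refine Finset.measurable_sum _ fun j _ => ?_
  exact Measurable.ite (measurableSet_le ((hz j).comp measurable_fst) measurable_snd)
    measurable_const measurable_const

theorem abs_countLE_sub_le {n : ℕ} {z z' : Fin n → ℝ} (h : Neighbors z z') (t : ℝ) :
    |countLE z t - countLE z' t| ≤ 1 := by
  obtain ⟨j, hj⟩ := h
  have e : ∀ z : Fin n → ℝ, countLE z t = ∑ i, if z i ≤ t then (1 : ℝ) else 0 := fun z => by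
    simp [countLE]
  rw [e, e, ← Finset.sum_sub_distrib, Finset.sum_eq_single j]
  · split_ifs <;> norm_num
  · intro i _ hi
    rw [hj i hi, sub_self]
  · simp

theorem measurable_privQuantile {P : Type*} [MeasurableSpace P] {n : ℕ} {z : P → Fin n → ℝ}
    (hz : ∀ j, Measurable fun w => z w j) (R : ℝ) (T : ℕ) (ρ q : ℝ) :
    Measurable fun w : P × (Fin T → ℝ) => privQuantile R T ρ (z w.1) q w.2 := by
  unfold privQuantile
  have := (measurable_noisySearch (measurable_countLE hz) (q * n) (√(T / (2 * ρ))) T).comp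
    (f := fun w : P × (Fin T → ℝ) => (w.1, w.2, ((-R, R) : ℝ × ℝ))) (by fun_prop)
  exact ((measurable_fst.comp this).add (measurable_snd.comp this)).div_const 2

theorem measurable_privQuantile_of_const {n : ℕ} (z : Fin n → ℝ) (R : ℝ) (T : ℕ) (ρ q : ℝ) :
    Measurable (privQuantile R T ρ z q) :=
  (measurable_privQuantile (P := Unit) (z := fun _ => z) (fun _ => measurable_const) R T ρ q).comp
    (f := fun g : Fin T → ℝ => ((), g)) (by fun_prop)

theorem measurable_countLE_of_const {n : ℕ} (z : Fin n → ℝ) : Measurable (countLE z) :=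
  (measurable_countLE (P := Unit) (z := fun _ => z) fun _ => measurable_const).comp
    (f := fun t : ℝ => ((), t)) (by fun_prop)

theorem holderDom_privQuantile (hα : 1 < α) {n : ℕ} {z z' : Fin n → ℝ} (h : Neighbors z z')
    (R : ℝ) (T : ℕ) {ρ : ℝ} (hρ : 0 < ρ) (q : ℝ) :
    HolderDom α ρ ((stdNormal T).map (privQuantile R T ρ z q))
      ((stdNormal T).map (privQuantile R T ρ z' q)) := by
  -- Without steps the noise level is `0`, but the output is the midpoint of the initial interval
  -- for all data.
  obtain rfl | hT := T.eq_zero_or_pos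
  · have e : privQuantile R 0 ρ z q = privQuantile R 0 ρ z' q := by
      ext g; simp [privQuantile, noisySearch]
    rw [e]
    have : IsProbabilityMeasure ((stdNormal 0).map (privQuantile R 0 ρ z' q)) :=
      Measure.isProbabilityMeasure_map (measurable_privQuantile_of_const z' R 0 ρ q).aemeasurable
    exact (HolderDom.refl hα _).mono hα hρ.le
  have hT' : (0 : ℝ) < T := by exact_mod_cast hT
  have hsm : ∀ z : Fin n → ℝ, Measurable fun g : Fin T → ℝ =>
      noisySearch (countLE z) (q * n) (√(T / (2 * ρ))) T g (-R, R) := fun z =>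
    (measurable_noisySearch_of_const (measurable_countLE_of_const z) _ _ T).comp
      measurable_prodMk_left
  have key := (holderDom_noisySearch hα (measurable_countLE_of_const z)
    (measurable_countLE_of_const z') (abs_countLE_sub_le h) (q * n)
    (s := √(T / (2 * ρ))) (by positivity) T (-R, R)).map
    (F := fun I : ℝ × ℝ => (I.1 + I.2) / 2) (by fun_prop)
  rw [Measure.map_map (by fun_prop) (hsm z), Measure.map_map (by fun_prop) (hsm z')] at key
  refine HolderDom.mono hα key ?_
  -- With `s² = T / (2ρ)` the total cost `T / (2 s²)` is exactly `ρ`.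
  rw [Real.sq_sqrt (by positivity)]
  apply le_of_eq
  field_simp

/-! ### Privacy of the mechanism -/

/-- The coordinatewise private median spends its budget evenly on the coordinates. -/
theorem holderDom_roughMean (hα : 1 < α) {d n : ℕ} (M : ℝ) {ρ₁ : ℝ} (hρ : 0 < ρ₁)
    {x x' : Fin n → EuclideanSpace ℝ (Fin d)} (h : Neighbors x x') :
    HolderDom α ρ₁
      ((Measure.pi fun _ : Fin d => stdNormal (stepsMedian M)).map (roughMean M ρ₁ x))
      ((Measure.pi fun _ : Fin d => stdNormal (stepsMedian M)).map (roughMean M ρ₁ x')) := by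
  obtain ⟨j, hj⟩ := h
  have hm : ∀ (x : Fin n → EuclideanSpace ℝ (Fin d)) (i : Fin d), Measurable
      (privQuantile M (stepsMedian M) (ρ₁ / d) (fun j => x j i) (1 / 2)) := fun x i =>
    measurable_privQuantile_of_const _ _ _ _ _
  have key := (HolderDom.pi hα (μ := fun _ : Fin d => stdNormal (stepsMedian M))
    (ε := fun _ => ρ₁ / d) (hm x) (hm x') (fun i => by
      have hd : (0 : ℝ) < d := by exact_mod_cast i.pos
      exact holderDom_privQuantile hα ⟨j, fun k hk => by rw [hj k hk]⟩ _ _ (by positivity) _)).map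
    (F := (WithLp.toLp 2 : (Fin d → ℝ) → EuclideanSpace ℝ (Fin d))) (by fun_prop)
  have hpm : ∀ x : Fin n → EuclideanSpace ℝ (Fin d), Measurable
      fun (g : Fin d → Fin (stepsMedian M) → ℝ) i =>
        privQuantile M (stepsMedian M) (ρ₁ / d) (fun j => x j i) (1 / 2) (g i) := fun x =>
    measurable_pi_lambda _ fun i => (hm x i).comp (measurable_pi_apply i)
  rw [Measure.map_map (by fun_prop) (hpm x), Measure.map_map (by fun_prop) (hpm x')] at key
  refine HolderDom.mono hα key ?_
  rw [Finset.sum_const, Finset.card_univ, Fintype.card_fin, nsmul_eq_mul]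
  obtain rfl | hd := d.eq_zero_or_pos
  · simpa using hρ.le
  · have hd : (0 : ℝ) < d := by exact_mod_cast hd
    apply le_of_eq; field_simp

/-- The last stage of the mechanism, given the center `c` and the clipping radius `C`. -/
noncomputable def release {d n : ℕ} (ρ₃ : ℝ) (σhat : Fin d → ℝ) (x : Fin n → EuclideanSpace ℝ (Fin d))
    (c : EuclideanSpace ℝ (Fin d)) (C : ℝ) (g : Fin d → ℝ) : EuclideanSpace ℝ (Fin d) :=
  c + (1 / (n : ℝ)) • unscale σhat
    ((∑ j, min (C / ‖rescale σhat c (x j)‖) 1 • rescale σhat c (x j)) +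
      WithLp.toLp 2 fun i => √(2 * C ^ 2 / ρ₃) * g i)

theorem plan_eq_release {d n : ℕ} (M k ρ₁ ρ₂ ρ₃ : ℝ) (σhat : Fin d → ℝ)
    (x : Fin n → EuclideanSpace ℝ (Fin d)) (ω : Noise d (stepsMedian M) (stepsClip d M)) :
    plan M k ρ₁ ρ₂ ρ₃ σhat x ω = release ρ₃ σhat x (roughMean M ρ₁ x ω.1)
      (clipRadius M k ρ₂ (fun j => rescale σhat (roughMean M ρ₁ x ω.1) (x j)) ω.2.1) ω.2.2 := rfl

theorem measurable_rescale {d : ℕ} (σhat : Fin d → ℝ) (x : EuclideanSpace ℝ (Fin d)) :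
    Measurable fun c => rescale σhat c x := by
  unfold rescale
  exact (by fun_prop : Measurable (WithLp.toLp 2 : (Fin d → ℝ) → EuclideanSpace ℝ (Fin d))).comp
    (measurable_pi_lambda _ fun i => by fun_prop)

theorem measurable_unscale {d : ℕ} (σhat : Fin d → ℝ) : Measurable (unscale σhat) := by
  unfold unscale
  exact (by fun_prop : Measurable (WithLp.toLp 2 : (Fin d → ℝ) → EuclideanSpace ℝ (Fin d))).comp
    (measurable_pi_lambda _ fun i => by fun_prop)

theorem measurable_release {d n : ℕ} (ρ₃ : ℝ) (σhat : Fin d → ℝ)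
    (x : Fin n → EuclideanSpace ℝ (Fin d)) :
    Measurable fun w : EuclideanSpace ℝ (Fin d) × ℝ × (Fin d → ℝ) =>
      release ρ₃ σhat x w.1 w.2.1 w.2.2 := by
  unfold release
  have key : Measurable fun w : EuclideanSpace ℝ (Fin d) × ℝ × (Fin d → ℝ) =>
      unscale σhat ((∑ j, min (w.2.1 / ‖rescale σhat w.1 (x j)‖) 1 •
        rescale σhat w.1 (x j)) + WithLp.toLp 2 fun i => √(2 * w.2.1 ^ 2 / ρ₃) * w.2.2 i) := by
    refine (measurable_unscale σhat).comp (Measurable.add ?_ ?_)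
    · refine Finset.measurable_sum _ fun j _ => ?_
      have h : Measurable fun w : EuclideanSpace ℝ (Fin d) × ℝ × (Fin d → ℝ) =>
        rescale σhat w.1 (x j) := (measurable_rescale σhat (x j)).comp measurable_fst
      exact Measurable.smul (Measurable.min ((by fun_prop : Measurable
        fun w : EuclideanSpace ℝ (Fin d) × ℝ × (Fin d → ℝ) => w.2.1).div h.norm)
          measurable_const) h
    · exact (by fun_prop : Measurable
        (WithLp.toLp 2 : (Fin d → ℝ) → EuclideanSpace ℝ (Fin d))).comp
          (measurable_pi_lambda _ fun i => by fun_prop)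
  exact measurable_fst.add (key.const_smul (1 / (n : ℝ)))

/-- The absolute value is needed because the search for the radius runs over a symmetric interval
and may return a negative `C`. -/
theorem norm_clip_le {E : Type*} [NormedAddCommGroup E] [NormedSpace ℝ E] (C : ℝ) (y : E) :
    ‖min (C / ‖y‖) 1 • y‖ ≤ |C| := by
  obtain h0 | h0 := (norm_nonneg y).eq_or_lt
  · rw [norm_smul, ← h0, mul_zero]; positivity
  rw [norm_smul, Real.norm_eq_abs]
  have : |min (C / ‖y‖) 1| ≤ |C| / ‖y‖ := by
    rw [abs_le]
    constructor
    · refine le_min ?_ ?_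
      · rw [neg_le, ← neg_div]; gcongr; exact neg_le_abs C
      · exact le_trans (neg_nonpos.2 (by positivity)) zero_le_one
    · refine (min_le_left _ _).trans ?_
      gcongr; exact le_abs_self C
  calc |min (C / ‖y‖) 1| * ‖y‖ ≤ |C| / ‖y‖ * ‖y‖ := by gcongr
    _ = |C| := by field_simp

/-- For fixed `c` and `C` the clipped sums of neighbours differ by a vector of norm at most `2|C|`.
Noise of variance `2 C² / ρ₃` turns this into a shift of cost `(2C)² / (2 * (2 C² / ρ₃)) = ρ₃`. -/
theorem holderDom_release (hα : 1 < α) {d n : ℕ} {ρ₃ : ℝ} (hρ : 0 < ρ₃) (σhat : Fin d → ℝ)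
    {x x' : Fin n → EuclideanSpace ℝ (Fin d)} (h : Neighbors x x')
    (c : EuclideanSpace ℝ (Fin d)) (C : ℝ) :
    HolderDom α ρ₃ ((stdNormal d).map (release ρ₃ σhat x c C))
      ((stdNormal d).map (release ρ₃ σhat x' c C)) := by
  set S : (Fin n → EuclideanSpace ℝ (Fin d)) → EuclideanSpace ℝ (Fin d) := fun x =>
    ∑ j, min (C / ‖rescale σhat c (x j)‖) 1 • rescale σhat c (x j) with hS
  set s := √(2 * C ^ 2 / ρ₃) with hs
  have hdiff : ‖S x - S x'‖ ≤ 2 * |C| := by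
    obtain ⟨j, hj⟩ := h
    rw [hS]
    simp only [← Finset.sum_sub_distrib]
    rw [Finset.sum_eq_single j]
    · refine (norm_sub_le _ _).trans ?_
      rw [two_mul]
      exact add_le_add (norm_clip_le _ _) (norm_clip_le _ _)
    · intro i _ hi
      rw [hj i hi, sub_self]
    · simp
  have hss : s ^ 2 = 2 * C ^ 2 / ρ₃ := Real.sq_sqrt (by positivity)
  set δ : Fin d → ℝ := fun i => (S x - S x') i / s with hδ
  have hrel : release ρ₃ σhat x c C = fun g => release ρ₃ σhat x' c C fun i => g i + δ i := by
    ext1 g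
    unfold release
    congr 3
    ext i
    change S x i + s * g i = S x' i + s * (g i + δ i)
    -- If the noise vanishes then `C = 0`, and the two clipped sums coincide.
    by_cases hs0 : s = 0
    · have hC : C = 0 := by
        have : 2 * C ^ 2 / ρ₃ = 0 := by rw [← hss, hs0]; norm_num
        simpa [hρ.ne'] using this
      have : S x - S x' = 0 := by
        rw [← norm_le_zero_iff]
        simpa [hC] using hdiff
      rw [hs0, sub_eq_zero.1 this]; simp
    · simp only [hδ, PiLp.sub_apply]
      field_simp; ring
  rw [hrel]
  refine (holderDom_stdNormal_comp hα δ ((measurable_release ρ₃ σhat x').comp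
    (measurable_const.prodMk (measurable_const.prodMk measurable_id)))).mono hα ?_
  have hsum : ∑ i, δ i ^ 2 / 2 = ‖S x - S x'‖ ^ 2 / s ^ 2 / 2 := by
    rw [EuclideanSpace.norm_sq_eq, Finset.sum_div, Finset.sum_div]
    simp [hδ, div_pow]
  rw [hsum, hss]
  by_cases hC : C = 0
  · simpa [hC] using hρ.le
  have h4 : ‖S x - S x'‖ ^ 2 ≤ 4 * C ^ 2 := by
    calc ‖S x - S x'‖ ^ 2 ≤ (2 * |C|) ^ 2 := by gcongr
      _ = 4 * C ^ 2 := by rw [mul_pow, sq_abs]; norm_num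
  have hC2 : 0 < C ^ 2 := by positivity
  calc ‖S x - S x'‖ ^ 2 / (2 * C ^ 2 / ρ₃) / 2 ≤ 4 * C ^ 2 / (2 * C ^ 2 / ρ₃) / 2 := by gcongr
    _ = ρ₃ := by field_simp; norm_num

theorem measurable_roughMean {d n : ℕ} (M ρ₁ : ℝ) (x : Fin n → EuclideanSpace ℝ (Fin d)) :
    Measurable (roughMean M ρ₁ x) := by
  unfold roughMean
  refine (by fun_prop : Measurable (WithLp.toLp 2 : (Fin d → ℝ) → EuclideanSpace ℝ (Fin d))).comp
    (measurable_pi_lambda _ fun i => ?_)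
  exact (measurable_privQuantile_of_const _ _ _ _ _).comp (measurable_pi_apply i)

theorem measurable_clipRadius {d n : ℕ} (M k ρ₂ : ℝ) (σhat : Fin d → ℝ)
    (x : Fin n → EuclideanSpace ℝ (Fin d)) :
    Measurable fun w : EuclideanSpace ℝ (Fin d) × (Fin (stepsClip d M) → ℝ) =>
      clipRadius M k ρ₂ (fun j => rescale σhat w.1 (x j)) w.2 := by
  unfold clipRadius
  exact measurable_privQuantile (z := fun c j => ‖rescale σhat c (x j)‖)
    (fun j => (measurable_rescale σhat (x j)).norm) _ _ _ _

/-- The stages of the mechanism after the center `c` has been chosen. -/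
theorem measurable_release_clipRadius {d n : ℕ} (M k ρ₂ ρ₃ : ℝ) (σhat : Fin d → ℝ)
    (x : Fin n → EuclideanSpace ℝ (Fin d)) :
    Measurable (Function.uncurry fun (c : EuclideanSpace ℝ (Fin d))
      (w : (Fin (stepsClip d M) → ℝ) × (Fin d → ℝ)) =>
      release ρ₃ σhat x c (clipRadius M k ρ₂ (fun j => rescale σhat c (x j)) w.1) w.2) :=
  (measurable_release ρ₃ σhat x).comp (measurable_fst.prodMk
    (((measurable_clipRadius M k ρ₂ σhat x).comp
      (measurable_fst.prodMk (measurable_fst.comp measurable_snd))).prodMk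
      (measurable_snd.comp measurable_snd)))

theorem measurable_plan {d n : ℕ} (M k ρ₁ ρ₂ ρ₃ : ℝ) (σhat : Fin d → ℝ)
    (x : Fin n → EuclideanSpace ℝ (Fin d)) : Measurable (plan M k ρ₁ ρ₂ ρ₃ σhat x) := by
  have := (measurable_release_clipRadius M k ρ₂ ρ₃ σhat x).comp
    (((measurable_roughMean M ρ₁ x).comp
      (measurable_fst (α := Fin d → Fin (stepsMedian M) → ℝ)
        (β := (Fin (stepsClip d M) → ℝ) × (Fin d → ℝ)))).prodMk measurable_snd)
  exact this

/-- Two nested compositions: for fixed `c` the radius is followed by the release, and `c` itself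
comes from the private medians. For fixed `c` rescaling acts on each data point separately, so
neighbouring datasets yield neighbouring lists of norms. -/
theorem holderDom_planLaw (hα : 1 < α) {d n : ℕ} (M k : ℝ) {ρ₁ ρ₂ ρ₃ : ℝ} (h₁ : 0 < ρ₁)
    (h₂ : 0 < ρ₂) (h₃ : 0 < ρ₃) (σhat : Fin d → ℝ) {x x' : Fin n → EuclideanSpace ℝ (Fin d)}
    (h : Neighbors x x') :
    HolderDom α (ρ₁ + (ρ₂ + ρ₃)) (planLaw M k ρ₁ ρ₂ ρ₃ σhat x)
      (planLaw M k ρ₁ ρ₂ ρ₃ σhat x') := by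
  have hclip : ∀ (x : Fin n → EuclideanSpace ℝ (Fin d)) (c : EuclideanSpace ℝ (Fin d)),
      Measurable (clipRadius M k ρ₂ fun j => rescale σhat c (x j)) := fun x c =>
    (measurable_clipRadius M k ρ₂ σhat x).comp
      (f := fun g : Fin (stepsClip d M) → ℝ => (c, g)) measurable_prodMk_left
  have hrel : ∀ (x : Fin n → EuclideanSpace ℝ (Fin d)) (c : EuclideanSpace ℝ (Fin d)),
      Measurable (Function.uncurry (release ρ₃ σhat x c)) := fun x c =>
    (measurable_release ρ₃ σhat x).comp
      (f := fun w : ℝ × (Fin d → ℝ) => (c, w)) measurable_prodMk_left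
  have hq : ∀ c : EuclideanSpace ℝ (Fin d), HolderDom α ρ₂
      ((stdNormal (stepsClip d M)).map (clipRadius M k ρ₂ fun j => rescale σhat c (x j)))
      ((stdNormal (stepsClip d M)).map (clipRadius M k ρ₂ fun j => rescale σhat c (x' j))) := by
    intro c
    obtain ⟨j, hj⟩ := h
    unfold clipRadius
    exact holderDom_privQuantile hα (z := fun j => ‖rescale σhat c (x j)‖)
      (z' := fun j => ‖rescale σhat c (x' j)‖) ⟨j, fun i hi => by simp only [hj i hi]⟩ _ _ h₂ _
  have hin : ∀ c : EuclideanSpace ℝ (Fin d), HolderDom α (ρ₂ + ρ₃)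
      (((stdNormal (stepsClip d M)).prod (stdNormal d)).map fun w =>
        release ρ₃ σhat x c (clipRadius M k ρ₂ (fun j => rescale σhat c (x j)) w.1) w.2)
      (((stdNormal (stepsClip d M)).prod (stdNormal d)).map fun w =>
        release ρ₃ σhat x' c (clipRadius M k ρ₂ (fun j => rescale σhat c (x' j)) w.1) w.2) :=
    fun c => HolderDom.comp (B := release ρ₃ σhat x c) (B' := release ρ₃ σhat x' c) hα
      (hclip x c) (hclip x' c) (hrel x c) (hrel x' c) (hq c)
      fun C => holderDom_release hα h₃ σhat h c C
  have key := HolderDom.comp hα (measurable_roughMean M ρ₁ x) (measurable_roughMean M ρ₁ x')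
    (measurable_release_clipRadius M k ρ₂ ρ₃ σhat x)
    (measurable_release_clipRadius M k ρ₂ ρ₃ σhat x')
    (holderDom_roughMean hα M h₁ h) hin
  unfold planLaw noiseLaw
  exact key

theorem isZCDP_planLaw {d n : ℕ} (M k : ℝ) {ρ₁ ρ₂ ρ₃ : ℝ} (h₁ : 0 < ρ₁) (h₂ : 0 < ρ₂)
    (h₃ : 0 < ρ₃) (σhat : Fin d → ℝ) :
    IsZCDP (fun x : Fin n → EuclideanSpace ℝ (Fin d) => planLaw M k ρ₁ ρ₂ ρ₃ σhat x)
      (ρ₁ + (ρ₂ + ρ₃)) := by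
  have hprob : ∀ x : Fin n → EuclideanSpace ℝ (Fin d),
      IsProbabilityMeasure (planLaw M k ρ₁ ρ₂ ρ₃ σhat x) := fun x =>
    Measure.isProbabilityMeasure_map (measurable_plan M k ρ₁ ρ₂ ρ₃ σhat x).aemeasurable
  refine ⟨hprob, fun α hα x x' h => ?_⟩
  have := hprob x
  have := hprob x'
  exact (holderDom_planLaw hα M k h₁ h₂ h₃ σhat h).renyiDiv_le hα

end

/-! ### Accuracy of the noisy binary search -/

theorem noisySearch_width (cnt : ℝ → ℝ) (m s : ℝ) : ∀ (T : ℕ) (g : Fin T → ℝ) (I : ℝ × ℝ),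
    (noisySearch cnt m s T g I).2 - (noisySearch cnt m s T g I).1 = (I.2 - I.1) / 2 ^ T
  | 0, _, I => by simp [noisySearch]
  | T + 1, g, I => by
    rw [noisySearch_succ, noisySearch_width cnt m s T]
    unfold searchStep
    split_ifs <;> (simp only; field_simp; ring)

theorem noisySearch_mem (cnt : ℝ → ℝ) (m s : ℝ) : ∀ (T : ℕ) (g : Fin T → ℝ) (I : ℝ × ℝ),
    I.1 ≤ I.2 → I.1 ≤ (noisySearch cnt m s T g I).1 ∧ (noisySearch cnt m s T g I).2 ≤ I.2
  | 0, _, I, _ => by simp [noisySearch]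
  | T + 1, g, I, h => by
    rw [noisySearch_succ]
    have h1 : I.1 ≤ (searchStep cnt m s (g 0) I).1 ∧ (searchStep cnt m s (g 0) I).2 ≤ I.2 ∧
        (searchStep cnt m s (g 0) I).1 ≤ (searchStep cnt m s (g 0) I).2 := by
      unfold searchStep
      split_ifs <;> refine ⟨?_, ?_, ?_⟩ <;> simp only <;> linarith
    have h2 := noisySearch_mem cnt m s T (Fin.tail g) _ h1.2.2
    exact ⟨h1.1.trans h2.1, h2.2.trans h1.2.1⟩

/-- Endpoint properties that are enforced by the outcome of a comparison are invariants. -/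
theorem noisySearch_invariant {cnt : ℝ → ℝ} {m s u : ℝ} {L R : ℝ → Prop}
    (hL : ∀ t v, |v| ≤ u → cnt t + s * v < m → L t)
    (hR : ∀ t v, |v| ≤ u → m ≤ cnt t + s * v → R t) :
    ∀ (T : ℕ) (g : Fin T → ℝ) (I : ℝ × ℝ), (∀ i, |g i| ≤ u) → L I.1 → R I.2 →
      L (noisySearch cnt m s T g I).1 ∧ R (noisySearch cnt m s T g I).2
  | 0, _, _, _, h1, h2 => ⟨h1, h2⟩
  | T + 1, g, I, hg, h1, h2 => by
    rw [noisySearch_succ]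
    refine noisySearch_invariant hL hR T _ _ (fun i => hg i.succ) ?_ ?_ <;>
      (unfold searchStep; split_ifs with h)
    · exact hL _ _ (hg 0) h
    · exact h1
    · exact h2
    · exact hR _ _ (hg 0) (not_lt.1 h)

theorem div_two_pow_searchSteps_le {R τ : ℝ} (hR : 0 < R) (hτ : 0 < τ) :
    R / 2 ^ searchSteps R τ ≤ τ := by
  have h : Real.logb 2 (R / τ) ≤ searchSteps R τ := Nat.le_ceil _
  rw [Real.logb_le_iff_le_rpow one_lt_two (by positivity), Real.rpow_natCast] at h
  rw [div_le_iff₀ (by positivity)]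
  rwa [div_le_iff₀ hτ, mul_comm] at h

theorem countLE_eq {n : ℕ} {z : Fin n → ℝ} {t : ℝ} (h : ∀ j, z j ≤ t) : countLE z t = n := by
  simp [countLE, h]

theorem countLE_add_card_lt {n : ℕ} (z : Fin n → ℝ) (t : ℝ) :
    countLE z t + ((Finset.univ.filter fun j => t < z j).card : ℝ) = n := by
  have := Finset.card_filter_add_card_filter_not (s := (Finset.univ : Finset (Fin n)))
    fun j => z j ≤ t
  simp only [not_le, Finset.card_univ, Fintype.card_fin] at this
  unfold countLE
  exact_mod_cast this

/-- The private median is close to every center around which the data concentrate. -/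
theorem abs_privQuantile_median_sub_le {n : ℕ} (hn : 0 < n) {R τ ρ u μ c : ℝ} {z : Fin n → ℝ}
    (hR : 0 < R) (hτ : 0 < τ) (hμ : |μ| ≤ R) (hc : 0 ≤ c)
    (hz : ((Finset.univ.filter fun j => c < |z j - μ|).card : ℝ) ≤ n / 4)
    (hu : √((searchSteps R τ : ℕ) / (2 * ρ)) * u ≤ n / 8) {g : Fin (searchSteps R τ) → ℝ}
    (hg : ∀ i, |g i| ≤ u) :
    |privQuantile R (searchSteps R τ) ρ z (1 / 2) g - μ| ≤ c + τ := by
  have hn' : (0 : ℝ) < n := by exact_mod_cast hn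
  set s := √((searchSteps R τ : ℕ) / (2 * ρ)) with hs
  have hs0 : 0 ≤ s := Real.sqrt_nonneg _
  have hsv : ∀ v : ℝ, |v| ≤ u → |s * v| ≤ n / 8 := fun v hv => by
    rw [abs_mul, abs_of_nonneg hs0]
    exact (mul_le_mul_of_nonneg_left hv hs0).trans hu
  have hμ' := abs_le.1 hμ
  -- Above `μ + c` the count is at least `3n/4`, and below `μ - c` it is at most `n/4`. Noise of
  -- size at most `n/8` cannot reverse the comparison with `n/2`, so the left endpoint stays at most
  -- `μ + c` and the right one at least `μ - c`.
  have key := noisySearch_invariant (cnt := countLE z) (m := 1 / 2 * n) (s := s) (u := u)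
    (L := fun t => t ≤ μ + c) (R := fun t => μ - c ≤ t)
    (fun t v hv h => by
      by_contra! ht
      have h1 := countLE_add_card_lt z t
      have h2 : ((Finset.univ.filter fun j => t < z j).card : ℝ) ≤ n / 4 := by
        refine le_trans ?_ hz
        exact_mod_cast Finset.card_le_card fun j hj => by
          simp only [Finset.mem_filter, Finset.mem_univ, true_and] at hj ⊢
          exact lt_of_lt_of_le (by linarith) (le_abs_self _)
      have := (abs_le.1 (hsv v hv)).1
      linarith)
    (fun t v hv h => by
      by_contra! ht
      have h2 : countLE z t ≤ n / 4 := by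
        refine le_trans ?_ hz
        unfold countLE
        exact_mod_cast Finset.card_le_card fun j hj => by
          simp only [Finset.mem_filter, Finset.mem_univ, true_and] at hj ⊢
          exact lt_of_lt_of_le (by linarith) (neg_le_abs _)
      have := (abs_le.1 (hsv v hv)).2
      linarith)
    (searchSteps R τ) g (-R, R) hg (by simp only; linarith) (by simp only; linarith)
  have hw := noisySearch_width (countLE z) (1 / 2 * n) s (searchSteps R τ) g (-R, R)
  have hτ' := div_two_pow_searchSteps_le hR hτ
  have e : (R - -R) / 2 ^ searchSteps R τ = 2 * (R / 2 ^ searchSteps R τ) := by ring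
  simp only [e] at hw
  simp only [privQuantile]
  rw [abs_le]
  constructor <;> linarith [key.1, key.2]

theorem abs_privQuantile_le {n : ℕ} {R : ℝ} (hR : 0 ≤ R) (T : ℕ) (ρ q : ℝ) (z : Fin n → ℝ)
    (g : Fin T → ℝ) : |privQuantile R T ρ z q g| ≤ R := by
  have h1 := noisySearch_mem (countLE z) (q * n) (√(T / (2 * ρ))) T g (-R, R)
    (by simp only; linarith)
  have h2 := noisySearch_width (countLE z) (q * n) (√(T / (2 * ρ))) T g (-R, R)
  have h3 : 0 ≤ (R - -R) / 2 ^ T := div_nonneg (by linarith) (by positivity)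
  simp only at h1 h2
  simp only [privQuantile]
  rw [abs_le]
  constructor <;> linarith

/-- The private upper quantile of nonnegative data is at most slightly larger than their maximum,
and at most slightly smaller than a threshold `r` that few data points exceed. -/
theorem privQuantile_upper {n : ℕ} (hn : 0 < n) {R τ ρ u k N U : ℝ} {z : Fin n → ℝ}
    (hR : 0 < R) (hτ : 0 < τ) (hz0 : ∀ j, 0 ≤ z j) (hzR : ∀ j, z j ≤ R) (hzU : ∀ j, z j ≤ U)
    (hU : 0 ≤ U) (hu : √((searchSteps R τ : ℕ) / (2 * ρ)) * u ≤ N) (hN : 0 ≤ N) (hNk : N ≤ k)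
    (hkn : k + N < n) {g : Fin (searchSteps R τ) → ℝ} (hg : ∀ i, |g i| ≤ u) :
    privQuantile R (searchSteps R τ) ρ z ((n - k) / n) g ≤ U + τ ∧
    ∃ r, 0 ≤ r ∧ r ≤ privQuantile R (searchSteps R τ) ρ z ((n - k) / n) g + τ ∧
      ((Finset.univ.filter fun j => r < z j).card : ℝ) ≤ k + N := by
  have hn' : (0 : ℝ) < n := by exact_mod_cast hn
  set s := √((searchSteps R τ : ℕ) / (2 * ρ)) with hs
  have hs0 : 0 ≤ s := Real.sqrt_nonneg _
  have hsv : ∀ v : ℝ, |v| ≤ u → |s * v| ≤ N := fun v hv => by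
    rw [abs_mul, abs_of_nonneg hs0]
    exact (mul_le_mul_of_nonneg_left hv hs0).trans hu
  have hm : (n - k) / n * n = n - k := by field_simp
  -- Above `U` the count is `n`, and since `N ≤ k` the noise cannot push it below `n - k`; so the
  -- left endpoint never passes `U`. A move of the right endpoint to `t` certifies a count of at
  -- least `n - k - N` there.
  have key := noisySearch_invariant (cnt := countLE z) (m := n - k) (s := s) (u := u)
    (L := fun t => t ≤ U) (R := fun t => n - k - N ≤ countLE z t)
    (fun t v hv h => by
      by_contra! ht
      have h1 : countLE z t = n := countLE_eq fun j => (hzU j).trans ht.le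
      have := (abs_le.1 (hsv v hv)).1
      linarith)
    (fun t v hv h => by
      have := (abs_le.1 (hsv v hv)).2
      linarith)
    (searchSteps R τ) g (-R, R) hg (by simp only; linarith)
    (by rw [countLE_eq hzR]; linarith)
  have hw := noisySearch_width (countLE z) (n - k) s (searchSteps R τ) g (-R, R)
  have hτ' := div_two_pow_searchSteps_le hR hτ
  have e : (R - -R) / 2 ^ searchSteps R τ = 2 * (R / 2 ^ searchSteps R τ) := by ring
  simp only [e] at hw
  simp only [privQuantile, hm, ← hs]
  set J := noisySearch (countLE z) (n - k) s (searchSteps R τ) g (-R, R)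
  -- The threshold `r` is the right endpoint of the final interval. It is nonnegative, because a
  -- negative threshold has count `0 < n - k - N`.
  refine ⟨by linarith [key.1], J.2, ?_, by linarith, ?_⟩
  · by_contra! hr
    have h0 : countLE z J.2 = 0 := by
      unfold countLE
      rw [Nat.cast_eq_zero, Finset.card_eq_zero, Finset.filter_eq_empty_iff]
      exact fun j _ => not_le.2 (hr.trans_le (hz0 j))
    linarith [key.2]
  · have := countLE_add_card_lt z J.2
    linarith [key.2]

/-! ### The error of the last stage -/

theorem unscale_add {d : ℕ} (σhat : Fin d → ℝ) (v w : EuclideanSpace ℝ (Fin d)) :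
    unscale σhat (v + w) = unscale σhat v + unscale σhat w := by
  ext i; simp [unscale, mul_add]

theorem unscale_smul {d : ℕ} (σhat : Fin d → ℝ) (a : ℝ) (v : EuclideanSpace ℝ (Fin d)) :
    unscale σhat (a • v) = a • unscale σhat v := by
  ext i; simp [unscale, mul_left_comm]

theorem unscale_sum {d : ℕ} (σhat : Fin d → ℝ) {ι : Type*} (s : Finset ι)
    (v : ι → EuclideanSpace ℝ (Fin d)) :
    unscale σhat (∑ j ∈ s, v j) = ∑ j ∈ s, unscale σhat (v j) := by
  ext i; simp [unscale, Finset.mul_sum]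

theorem unscale_rescale {d : ℕ} {σhat : Fin d → ℝ} (hσ : ∀ i, 0 < σhat i)
    (c x : EuclideanSpace ℝ (Fin d)) : unscale σhat (rescale σhat c x) = x - c := by
  ext i
  have : √(σhat i) ≠ 0 := (Real.sqrt_pos.2 (hσ i)).ne'
  simp only [unscale, rescale, PiLp.sub_apply]
  field_simp

theorem norm_unscale_le {d : ℕ} {σhat : Fin d → ℝ} {b : ℝ} (hσ : ∀ i, σhat i ≤ b)
    (v : EuclideanSpace ℝ (Fin d)) : ‖unscale σhat v‖ ≤ √b * ‖v‖ := by
  have h0 : 0 ≤ √b * ‖v‖ := by positivity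
  rw [← abs_of_nonneg h0, ← abs_of_nonneg (norm_nonneg (unscale σhat v)), ← sq_le_sq, mul_pow,
    EuclideanSpace.norm_sq_eq, EuclideanSpace.norm_sq_eq, Finset.mul_sum]
  refine Finset.sum_le_sum fun i _ => ?_
  simp only [unscale, norm_mul, mul_pow, Real.norm_eq_abs, sq_abs]
  gcongr
  exact hσ i

/-- The error caused by clipping a single vector. -/
theorem clip_error_le {d : ℕ} {σhat : Fin d → ℝ} (hσ : ∀ i, 0 < σhat i) {b C r τ D : ℝ}
    (hb : ∀ i, σhat i ≤ b) (hτ : 0 ≤ τ) (hr : 0 ≤ r) (hrC : r ≤ C + τ)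
    {c x : EuclideanSpace ℝ (Fin d)} (hD : ‖x - c‖ ≤ D) :
    (1 - min (C / ‖rescale σhat c x‖) 1) * ‖x - c‖ ≤
      (if r < ‖rescale σhat c x‖ then D else 0) + τ * √b := by
  set y := rescale σhat c x with hy
  have hxy : ‖x - c‖ ≤ √b * ‖y‖ := by
    rw [← unscale_rescale hσ c x]; exact norm_unscale_le hb y
  have hD0 : 0 ≤ D := (norm_nonneg _).trans hD
  have hτb : 0 ≤ τ * √b := by positivity
  obtain h0 | h0 := (norm_nonneg y).eq_or_lt
  · have : ‖x - c‖ = 0 := le_antisymm (by simpa [← h0] using hxy) (norm_nonneg _)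
    rw [this, mul_zero]
    split_ifs <;> positivity
  have hy1 : τ / ‖y‖ * ‖x - c‖ ≤ τ * √b := by
    calc τ / ‖y‖ * ‖x - c‖ ≤ τ / ‖y‖ * (√b * ‖y‖) := by gcongr
      _ = τ * √b := by field_simp
  obtain hC | hC := le_total 1 (C / ‖y‖)
  · rw [min_eq_right hC, sub_self, zero_mul]
    split_ifs <;> positivity
  · rw [min_eq_left hC]
    split_ifs with h
    -- Only `C ≥ r - τ ≥ -τ` is known, so the factor `1 - C / ‖y‖` may slightly exceed `1`.
    · have h1 : 1 - C / ‖y‖ ≤ 1 + τ / ‖y‖ := by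
        have : -(τ / ‖y‖) ≤ C / ‖y‖ := by rw [← neg_div]; gcongr; linarith
        linarith
      calc (1 - C / ‖y‖) * ‖x - c‖ ≤ (1 + τ / ‖y‖) * ‖x - c‖ := by gcongr
        _ = ‖x - c‖ + τ / ‖y‖ * ‖x - c‖ := by ring
        _ ≤ _ := add_le_add hD hy1
    · rw [zero_add]
      refine le_trans ?_ hy1
      gcongr
      rw [le_div_iff₀ h0, sub_mul, div_mul_cancel₀ _ h0.ne']
      linarith

/-- The error of the last stage in terms of the sampling error, the number of clipped vectors and
the final noise. -/
theorem norm_release_sub_le {d n : ℕ} (hn : 0 < n) {σhat : Fin d → ℝ} (hσ : ∀ i, 0 < σhat i)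
    {b C r τ D N ρ₃ : ℝ} (hb : ∀ i, σhat i ≤ b) (hτ : 0 ≤ τ) (hr : 0 ≤ r) (hrC : r ≤ C + τ)
    {x : Fin n → EuclideanSpace ℝ (Fin d)} {c μ : EuclideanSpace ℝ (Fin d)}
    (hD : ∀ j, ‖x j - c‖ ≤ D)
    (hN : ((Finset.univ.filter fun j => r < ‖rescale σhat c (x j)‖).card : ℝ) ≤ N)
    (g : Fin d → ℝ) :
    ‖release ρ₃ σhat x c C g - μ‖ ≤ (‖∑ j, (x j - μ)‖ + N * D) / n + τ * √b +
      √(2 * C ^ 2 / ρ₃) / n * ‖unscale σhat (WithLp.toLp 2 g)‖ := by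
  have hn' : (0 : ℝ) < n := by exact_mod_cast hn
  have hD0 : 0 ≤ D := (norm_nonneg _).trans (hD ⟨0, hn⟩)
  set w : Fin n → ℝ := fun j => min (C / ‖rescale σhat c (x j)‖) 1 with hw
  set η := unscale σhat (WithLp.toLp 2 g) with hη
  -- Unscaling undoes rescaling, so without clipping the center `c` would cancel. It enters only
  -- through the clipped parts `(1 - w j) • (x j - c)`.
  have e1 : release ρ₃ σhat x c C g - μ = (1 / (n : ℝ)) •
      (∑ j, (x j - μ) - ∑ j, (1 - w j) • (x j - c) + √(2 * C ^ 2 / ρ₃) • η) := by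
    have hs : (WithLp.toLp 2 fun i => √(2 * C ^ 2 / ρ₃) * g i : EuclideanSpace ℝ (Fin d)) =
        √(2 * C ^ 2 / ρ₃) • WithLp.toLp 2 g := by ext i; simp
    have hsum : ∑ j, (x j - μ) - ∑ j, (1 - w j) • (x j - c) =
        (n : ℝ) • (c - μ) + ∑ j, w j • (x j - c) := by
      rw [← Finset.sum_sub_distrib]
      have : ∀ j, x j - μ - (1 - w j) • (x j - c) = (c - μ) + w j • (x j - c) := fun j => by
        rw [sub_smul, one_smul]; abel
      simp only [this, Finset.sum_add_distrib, Finset.sum_const, Finset.card_univ,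
        Fintype.card_fin, Nat.cast_smul_eq_nsmul]
    rw [hsum, release, unscale_add, unscale_sum, hs, unscale_smul]
    simp only [unscale_smul, unscale_rescale hσ]
    rw [← hη, add_assoc, smul_add _ ((n : ℝ) • (c - μ)), smul_smul, one_div_mul_cancel hn'.ne',
      one_smul]
    abel
  have e2 : ‖∑ j, (1 - w j) • (x j - c)‖ ≤ N * D + n * (τ * √b) := by
    calc ‖∑ j, (1 - w j) • (x j - c)‖ ≤ ∑ j, ‖(1 - w j) • (x j - c)‖ := norm_sum_le _ _
      _ ≤ ∑ j, ((if r < ‖rescale σhat c (x j)‖ then D else 0) + τ * √b) := by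
          refine Finset.sum_le_sum fun j _ => ?_
          rw [norm_smul, Real.norm_of_nonneg (sub_nonneg.2 (min_le_right _ _))]
          exact clip_error_le hσ hb hτ hr hrC (hD j)
      _ = ((Finset.univ.filter fun j => r < ‖rescale σhat c (x j)‖).card : ℝ) * D +
            n * (τ * √b) := by
          rw [Finset.sum_add_distrib, ← Finset.sum_filter]
          simp
      _ ≤ _ := by gcongr
  rw [e1, norm_smul, Real.norm_of_nonneg (by positivity)]
  have e3 := norm_add_le (∑ j, (x j - μ) - ∑ j, (1 - w j) • (x j - c)) (√(2 * C ^ 2 / ρ₃) • η)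
  have e4 := norm_sub_le (∑ j, (x j - μ)) (∑ j, (1 - w j) • (x j - c))
  rw [norm_smul, Real.norm_of_nonneg (Real.sqrt_nonneg _)] at e3
  calc 1 / (n : ℝ) * _ ≤ 1 / (n : ℝ) * (‖∑ j, (x j - μ)‖ + (N * D + n * (τ * √b)) +
        √(2 * C ^ 2 / ρ₃) * ‖η‖) := by gcongr; linarith
    _ = _ := by field_simp; ring

/-! ### Tails of Gaussian noise -/

/-- Markov's inequality for `exp (u c x)`; the sign `c` covers both tails. -/
theorem measure_lt_mul_gaussianReal_le {c u : ℝ} (hc : |c| = 1) (hu : 0 ≤ u) :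
    gaussianReal 0 1 {x | u < c * x} ≤ ENNReal.ofReal (Real.exp (-(u ^ 2 / 2))) := by
  have hc2 : c ^ 2 = 1 := by rw [← sq_abs, hc, one_pow]
  have h := mul_meas_ge_le_lintegral (μ := gaussianReal 0 1)
    (f := fun x => ENNReal.ofReal (Real.exp (u * c * x))) (by fun_prop)
    (ENNReal.ofReal (Real.exp (u ^ 2)))
  rw [lintegral_exp_mul_gaussianReal, mul_pow, hc2, mul_one] at h
  have h2 : gaussianReal 0 1 {x | u < c * x} ≤ gaussianReal 0 1
      {x | ENNReal.ofReal (Real.exp (u ^ 2)) ≤ ENNReal.ofReal (Real.exp (u * c * x))} := by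
    refine measure_mono fun x (hx : u < c * x) => ENNReal.ofReal_le_ofReal (Real.exp_le_exp.2 ?_)
    nlinarith
  have h3 := (mul_le_mul_right h2 _).trans h
  have e : ENNReal.ofReal (Real.exp (u ^ 2 / 2)) = ENNReal.ofReal (Real.exp (u ^ 2)) *
      ENNReal.ofReal (Real.exp (-(u ^ 2 / 2))) := by
    rw [← ENNReal.ofReal_mul (Real.exp_nonneg _), ← Real.exp_add]
    congr 2; ring
  rw [e] at h3
  exact (ENNReal.mul_le_mul_iff_right (by simp [Real.exp_pos]) ENNReal.ofReal_ne_top).1 h3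

theorem gaussianReal_tail_le {u : ℝ} (hu : 0 ≤ u) :
    (gaussianReal 0 1).real {x | u < |x|} ≤ 2 * Real.exp (-(u ^ 2 / 2)) := by
  have h : {x : ℝ | u < |x|} ⊆ {x | u < 1 * x} ∪ {x | u < (-1) * x} := fun x hx => by
    simpa [lt_abs] using hx
  have h1 : ∀ c : ℝ, |c| = 1 →
      (gaussianReal 0 1).real {x | u < c * x} ≤ Real.exp (-(u ^ 2 / 2)) := fun c hc =>
    ENNReal.toReal_le_of_le_ofReal (Real.exp_nonneg _) (measure_lt_mul_gaussianReal_le hc hu)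
  refine (measureReal_mono h).trans ((measureReal_union_le _ _).trans ?_)
  linarith [h1 1 (by simp), h1 (-1) (by simp)]

theorem pi_exists_mem_le {Ω : Type*} [MeasurableSpace Ω] {n : ℕ} (μ : Measure Ω)
    [IsProbabilityMeasure μ] {S : Set Ω} (hS : MeasurableSet S) :
    (Measure.pi fun _ : Fin n => μ).real {x | ∃ j, x j ∈ S} ≤ n * μ.real S := by
  have : {x : Fin n → Ω | ∃ j, x j ∈ S} = ⋃ j, Function.eval j ⁻¹' S := by
    ext x; simp
  rw [this]
  refine (measureReal_iUnion_fintype_le _).trans_eq ?_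
  have h : ∀ j : Fin n, (Measure.pi fun _ : Fin n => μ).real (Function.eval j ⁻¹' S) = μ.real S :=
    fun j => by
      rw [measureReal_def, (measurePreserving_eval (fun _ : Fin n => μ) j).measure_preimage
        hS.nullMeasurableSet, measureReal_def]
  simp [h]

theorem measurableSet_lt_abs (u : ℝ) : MeasurableSet {x : ℝ | u < |x|} :=
  measurableSet_lt measurable_const (by fun_prop)

theorem stdNormal_tail_le (m : ℕ) {u : ℝ} (hu : 0 ≤ u) :
    (stdNormal m).real {g | ∃ i, u < |g i|} ≤ m * (2 * Real.exp (-(u ^ 2 / 2))) := by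
  refine (pi_exists_mem_le (gaussianReal 0 1) (measurableSet_lt_abs u)).trans ?_
  gcongr
  exact gaussianReal_tail_le hu

/-- The random source is bounded by `u`. -/
def NoiseBounded {d T₁ T₂ : ℕ} (u : ℝ) (ω : Noise d T₁ T₂) : Prop :=
  (∀ i t, |ω.1 i t| ≤ u) ∧ (∀ t, |ω.2.1 t| ≤ u) ∧ ∀ i, |ω.2.2 i| ≤ u

theorem noiseLaw_not_noiseBounded_le (d T₁ T₂ : ℕ) {u : ℝ} (hu : 0 ≤ u) :
    (noiseLaw d T₁ T₂).real {ω | ¬ NoiseBounded u ω} ≤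
      (d * T₁ + T₂ + d) * (2 * Real.exp (-(u ^ 2 / 2))) := by
  have hm : ∀ m : ℕ, MeasurableSet {g : Fin m → ℝ | ∃ i, u < |g i|} := fun m => by
    have : {g : Fin m → ℝ | ∃ i, u < |g i|} = ⋃ i, {g | u < |g i|} := by ext; simp
    rw [this]
    exact MeasurableSet.iUnion fun i => measurableSet_lt measurable_const (by fun_prop)
  have hm1 : MeasurableSet {g : Fin d → Fin T₁ → ℝ | ∃ i, g i ∈ {g | ∃ t, u < |g t|}} := by
    have : {g : Fin d → Fin T₁ → ℝ | ∃ i, g i ∈ {g | ∃ t, u < |g t|}} =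
        ⋃ i, Function.eval i ⁻¹' {g | ∃ t, u < |g t|} := by ext; simp
    rw [this]
    exact MeasurableSet.iUnion fun i => (measurable_pi_apply i) (hm T₁)
  set A₁ : Set (Noise d T₁ T₂) :=
    Prod.fst ⁻¹' {g : Fin d → Fin T₁ → ℝ | ∃ i, g i ∈ {g | ∃ t, u < |g t|}} with hA₁
  set A₂ : Set (Noise d T₁ T₂) := Prod.snd ⁻¹' (Prod.fst ⁻¹' {g | ∃ t, u < |g t|}) with hA₂
  set A₃ : Set (Noise d T₁ T₂) := Prod.snd ⁻¹' (Prod.snd ⁻¹' {g | ∃ t, u < |g t|}) with hA₃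
  have hsub : {ω : Noise d T₁ T₂ | ¬ NoiseBounded u ω} ⊆ A₁ ∪ A₂ ∪ A₃ := by
    intro ω hω
    by_contra hcon
    simp only [hA₁, hA₂, hA₃, Set.mem_union, Set.mem_preimage, Set.mem_ofPred_eq, not_or,
      not_exists, not_lt] at hcon
    exact hω ⟨hcon.1.1, hcon.1.2, hcon.2⟩
  have h₁ : (noiseLaw d T₁ T₂).real A₁ ≤ d * (T₁ * (2 * Real.exp (-(u ^ 2 / 2)))) := by
    unfold noiseLaw
    rw [measureReal_def, hA₁, measurePreserving_fst.measure_preimage hm1.nullMeasurableSet]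
    refine (pi_exists_mem_le (stdNormal T₁) (hm T₁)).trans ?_
    gcongr
    exact stdNormal_tail_le T₁ hu
  have h₂ : (noiseLaw d T₁ T₂).real A₂ ≤ T₂ * (2 * Real.exp (-(u ^ 2 / 2))) := by
    unfold noiseLaw
    rw [measureReal_def, hA₂, measurePreserving_snd.measure_preimage
      (measurable_fst (hm T₂)).nullMeasurableSet,
      measurePreserving_fst.measure_preimage (hm T₂).nullMeasurableSet]
    exact stdNormal_tail_le T₂ hu
  have h₃ : (noiseLaw d T₁ T₂).real A₃ ≤ d * (2 * Real.exp (-(u ^ 2 / 2))) := by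
    unfold noiseLaw
    rw [measureReal_def, hA₃, measurePreserving_snd.measure_preimage
      (measurable_snd (hm d)).nullMeasurableSet,
      measurePreserving_snd.measure_preimage (hm d).nullMeasurableSet]
    exact stdNormal_tail_le d hu
  have h4 := measureReal_union_le (μ := noiseLaw d T₁ T₂) (A₁ ∪ A₂) A₃
  have h5 := measureReal_union_le (μ := noiseLaw d T₁ T₂) A₁ A₂
  have h6 := measureReal_mono (μ := noiseLaw d T₁ T₂) hsub
  linarith

/-! ### The number of outliers in a sample -/

/-- A Chernoff bound with exponent `1`: each point contributes a factor of mean at most `1 + 2/16 ≤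
exp (1/8)`, and Markov's inequality at `exp (n/4)` leaves `exp (n/8 - n/4)`. -/
theorem pi_card_gt_le {Ω : Type*} [MeasurableSpace Ω] {n : ℕ} (μ : Measure Ω)
    [IsProbabilityMeasure μ] {p : Ω → Prop} [DecidablePred p] (hp : MeasurableSet {x | p x})
    (hμ : μ.real {x | p x} ≤ 1 / 16) :
    (Measure.pi fun _ : Fin n => μ).real
      {x | (n : ℝ) / 4 < ((Finset.univ.filter fun j => p (x j)).card : ℝ)} ≤
      Real.exp (-(n / 8)) := by
  set f : Ω → ℝ := fun x => if p x then Real.exp 1 else 1 with hf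
  have hfm : Measurable f := Measurable.ite hp measurable_const measurable_const
  have hfi : Integrable f μ := by
    refine Integrable.of_bound hfm.aestronglyMeasurable (Real.exp 1) (ae_of_all _ fun x => ?_)
    simp only [hf]
    split_ifs
    · simp
    · simp
  have hfint : ∫ x, f x ∂μ ≤ Real.exp (1 / 8) := by
    have e : f = fun x => 1 + (Real.exp 1 - 1) * {x | p x}.indicator 1 x := by
      ext x
      by_cases h : p x <;> simp [hf, h]
    have hi : Integrable ({x | p x}.indicator (1 : Ω → ℝ)) μ :=
      (integrable_const (1 : ℝ)).indicator hp
    rw [e, integral_add (f := fun _ => (1 : ℝ)) (integrable_const _) (hi.const_mul _),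
      integral_const_mul, integral_indicator_one hp]
    simp only [integral_const, probReal_univ, smul_eq_mul, mul_one]
    have h1 := Real.add_one_le_exp (1 / 8 : ℝ)
    have h2 := Real.exp_one_lt_d9
    have h3 : (Real.exp 1 - 1) * μ.real {x | p x} ≤ 2 * (1 / 16) := by
      refine mul_le_mul (by linarith) hμ measureReal_nonneg (by norm_num)
    linarith
  have hpos : ∀ x, 0 < f x := fun x => by
    simp only [hf]; split_ifs <;> positivity
  have hF : ∀ x : Fin n → Ω, ∏ j, f (x j) =
      Real.exp ((Finset.univ.filter fun j => p (x j)).card : ℝ) := fun x => by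
    simp only [hf]
    rw [Finset.prod_ite]
    simp [← Real.exp_nat_mul]
  have key := mul_meas_ge_le_integral_of_nonneg (μ := Measure.pi fun _ : Fin n => μ)
    (f := fun x => ∏ j, f (x j))
    (ae_of_all _ fun x => Finset.prod_nonneg fun j _ => (hpos _).le)
    (Integrable.fintype_prod fun _ => hfi) (Real.exp (n / 4))
  rw [integral_fintype_prod_eq_pow (fun x => f x), Fintype.card_fin] at key
  have h1 : (Measure.pi fun _ : Fin n => μ).real
      {x | (n : ℝ) / 4 < ((Finset.univ.filter fun j => p (x j)).card : ℝ)} ≤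
      (Measure.pi fun _ : Fin n => μ).real {x | Real.exp (n / 4) ≤ ∏ j, f (x j)} := by
    refine measureReal_mono fun x hx => ?_
    simp only [Set.mem_ofPred_eq] at hx ⊢
    rw [hF, Real.exp_le_exp]
    exact hx.le
  have h2 : (∫ x, f x ∂μ) ^ n ≤ Real.exp (n / 8) := by
    calc (∫ x, f x ∂μ) ^ n ≤ Real.exp (1 / 8) ^ n := by
          exact pow_le_pow_left₀ (integral_nonneg fun x => (hpos x).le) hfint n
      _ = Real.exp (n / 8) := by rw [← Real.exp_nat_mul]; congr 1; ring
  have h3 : Real.exp (n / 8) = Real.exp (n / 4) * Real.exp (-(n / 8)) := by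
    rw [← Real.exp_add]; congr 1; ring
  have h4 := (key.trans h2).trans_eq h3
  exact h1.trans (le_of_mul_le_mul_left h4 (Real.exp_pos _))

/-! ### Rademacher sums -/

/-- The sign that is encoded by a Boolean. -/
def boolSign (b : Bool) : ℝ := if b then 1 else -1

/-- Hoeffding's bound as a count of sign patterns: `cosh z ≤ exp (z² / 2)` bounds the exponential
moment, and the optimal parameter is `u / √V`. -/
theorem card_rademacher_gt_le {n : ℕ} (v : Fin n → ℝ) {u : ℝ} (hu : 0 ≤ u) :
    ((Finset.univ.filter fun ε : Fin n → Bool =>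
      u * √(∑ j, v j ^ 2) < |∑ j, boolSign (ε j) * v j|).card : ℝ) ≤
      2 ^ n * (2 * Real.exp (-(u ^ 2 / 2))) := by
  set V := ∑ j, v j ^ 2 with hV
  have hV0 : 0 ≤ V := Finset.sum_nonneg fun j _ => sq_nonneg _
  set S := Finset.univ.filter fun ε : Fin n → Bool =>
      u * √V < |∑ j, boolSign (ε j) * v j| with hS
  obtain h0 | h0 := hV0.eq_or_lt
  · have hv : ∀ j, v j = 0 := fun j => by
      have := (Finset.sum_eq_zero_iff_of_nonneg fun j _ => sq_nonneg (v j)).1 h0.symm j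
        (Finset.mem_univ j)
      simpa using this
    have : S = ∅ := by
      rw [hS, Finset.filter_eq_empty_iff]
      intro ε _
      simp [hv, ← h0]
    rw [this]
    simp only [Finset.card_empty, Nat.cast_zero]
    positivity
  set l := u / √V with hl
  have hsV : 0 < √V := Real.sqrt_pos.2 h0
  have hexp : ∀ l : ℝ, ∑ ε : Fin n → Bool, Real.exp (l * ∑ j, boolSign (ε j) * v j) ≤
      2 ^ n * Real.exp (l ^ 2 * V / 2) := by
    intro l
    have h1 : ∀ ε : Fin n → Bool, Real.exp (l * ∑ j, boolSign (ε j) * v j) =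
        ∏ j, Real.exp (l * (boolSign (ε j) * v j)) := fun ε => by
      rw [← Real.exp_sum, Finset.mul_sum]
    simp only [h1]
    have h2 := Finset.prod_univ_sum (fun _ : Fin n => (Finset.univ : Finset Bool))
      (fun j b => Real.exp (l * (boolSign b * v j)))
    rw [Fintype.piFinset_univ] at h2
    rw [← h2]
    calc ∏ j, ∑ b : Bool, Real.exp (l * (boolSign b * v j))
        ≤ ∏ j, 2 * Real.exp ((l * v j) ^ 2 / 2) := by
          refine Finset.prod_le_prod (fun j _ => Finset.sum_nonneg fun b _ => Real.exp_nonneg _)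
            fun j _ => ?_
          have := Real.cosh_le_exp_half_sq (l * v j)
          rw [Real.cosh_eq] at this
          simp only [Fintype.sum_bool, boolSign, if_true, Bool.false_eq_true, if_false, one_mul,
            neg_mul, mul_neg]
          linarith
      _ = 2 ^ n * Real.exp (l ^ 2 * V / 2) := by
          rw [Finset.prod_mul_distrib, ← Real.exp_sum]
          simp only [Finset.prod_const, Finset.card_univ, Fintype.card_fin, hV]
          congr 2
          rw [Finset.mul_sum, Finset.sum_div]
          exact Finset.sum_congr rfl fun j _ => by ring
  have hcard : (S.card : ℝ) * Real.exp (u ^ 2) ≤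
      ∑ ε : Fin n → Bool, (Real.exp (l * ∑ j, boolSign (ε j) * v j) +
        Real.exp (-l * ∑ j, boolSign (ε j) * v j)) := by
    rw [← nsmul_eq_mul, ← Finset.sum_const]
    refine (Finset.sum_le_sum fun ε hε => ?_).trans
      (Finset.sum_le_sum_of_subset_of_nonneg (Finset.subset_univ S) fun ε _ _ => by positivity)
    rw [hS, Finset.mem_filter] at hε
    set z := ∑ j, boolSign (ε j) * v j
    have hlz : u ^ 2 ≤ l * |z| := by
      calc u ^ 2 = l * (u * √V) := by rw [hl]; field_simp
        _ ≤ l * |z| := by gcongr; exact hε.2.le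
    obtain h | h := abs_choice z
    · rw [h] at hlz
      exact (Real.exp_le_exp.2 hlz).trans (le_add_of_nonneg_right (Real.exp_nonneg _))
    · rw [h, mul_neg, ← neg_mul] at hlz
      exact (Real.exp_le_exp.2 hlz).trans (le_add_of_nonneg_left (Real.exp_nonneg _))
  rw [Finset.sum_add_distrib] at hcard
  have h1 := hexp l
  have h2 := hexp (-l)
  have hlV : l ^ 2 * V = u ^ 2 := by
    rw [hl, div_pow, Real.sq_sqrt hV0]; field_simp
  rw [neg_sq] at h2
  rw [hlV] at h1 h2
  have h3 : Real.exp (u ^ 2 / 2) = Real.exp (-(u ^ 2 / 2)) * Real.exp (u ^ 2) := by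
    rw [← Real.exp_add]; congr 1; ring
  rw [h3] at h1 h2
  refine le_of_mul_le_mul_right (hcard.trans ?_) (Real.exp_pos (u ^ 2))
  linarith

section

/-! ### Concentration of the sample mean -/

/-- Symmetric sums satisfy a self-normalized sub-Gaussian tail bound. -/
theorem pi_symmetric_sum_tail_le {Ω : Type*} [MeasurableSpace Ω] (D : Measure Ω)
    [IsProbabilityMeasure D] (n : ℕ) {f : Ω × Ω → ℝ} (hf : Measurable f)
    (hanti : ∀ p, f p.swap = -f p) {u : ℝ} (hu : 0 ≤ u) :
    (Measure.pi fun _ : Fin n => D.prod D).real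
      {w | u * √(∑ j, f (w j) ^ 2) < |∑ j, f (w j)|} ≤ 2 * Real.exp (-(u ^ 2 / 2)) := by
  set ν := Measure.pi fun _ : Fin n => D.prod D with hν
  set B : Set (Fin n → Ω × Ω) := {w | u * √(∑ j, f (w j) ^ 2) < |∑ j, f (w j)|} with hB
  have hfj : ∀ j : Fin n, Measurable fun w : Fin n → Ω × Ω => f (w j) := fun j =>
    hf.comp (measurable_pi_apply j)
  have hBm : MeasurableSet B := by
    refine measurableSet_lt (Measurable.const_mul (Measurable.sqrt ?_) _) (Measurable.abs ?_)
    · exact Finset.measurable_sum _ fun j _ => (hfj j).pow_const 2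
    · exact Finset.measurable_sum _ fun j _ => hfj j
  -- Swapping the entries of any set of pairs preserves the law and flips the corresponding signs of
  -- `f`. Averaging over all `2 ^ n` swaps reduces the claim to a count of sign patterns for each
  -- fixed `w`.
  let flip : (Fin n → Bool) → (Fin n → Ω × Ω) → (Fin n → Ω × Ω) := fun ε w j =>
    (if ε j then id else Prod.swap) (w j)
  have hflip : ∀ ε, MeasurePreserving (flip ε) ν ν := fun ε => by
    refine measurePreserving_pi (fun _ : Fin n => D.prod D) (fun _ : Fin n => D.prod D) fun j => ?_
    split_ifs
    · exact MeasurePreserving.id _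
    · exact Measure.measurePreserving_swap
  have hfflip : ∀ ε w j, f (flip ε w j) = boolSign (ε j) * f (w j) := fun ε w j => by
    simp only [flip, boolSign]
    split_ifs
    · simp
    · rw [hanti]; ring
  have hmem : ∀ ε w, w ∈ flip ε ⁻¹' B ↔
      u * √(∑ j, f (w j) ^ 2) < |∑ j, boolSign (ε j) * f (w j)| := fun ε w => by
    have hsq : ∀ b, boolSign b ^ 2 = 1 := fun b => by cases b <;> simp [boolSign]
    simp only [hB, Set.mem_preimage, Set.mem_ofPred_eq, hfflip, mul_pow, hsq, one_mul]
  have h1 : ∀ ε, ν.real B = ∫ w, (flip ε ⁻¹' B).indicator 1 w ∂ν := fun ε => by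
    rw [integral_indicator_one ((hflip ε).measurable hBm), measureReal_def, measureReal_def,
      (hflip ε).measure_preimage hBm.nullMeasurableSet]
  have hind : ∀ ε, Integrable ((flip ε ⁻¹' B).indicator (1 : (Fin n → Ω × Ω) → ℝ)) ν := fun ε =>
    (integrable_const (1 : ℝ)).indicator ((hflip ε).measurable hBm)
  have h2 : (2 : ℝ) ^ n * ν.real B =
      ∫ w, ∑ ε : Fin n → Bool, (flip ε ⁻¹' B).indicator (1 : (Fin n → Ω × Ω) → ℝ) w ∂ν := by
    rw [integral_finsetSum _ fun ε _ => hind ε]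
    rw [← Finset.sum_congr rfl fun ε _ => h1 ε]
    simp
  have h3 : ∫ w, ∑ ε : Fin n → Bool, (flip ε ⁻¹' B).indicator (1 : (Fin n → Ω × Ω) → ℝ) w ∂ν ≤
      ∫ _, 2 ^ n * (2 * Real.exp (-(u ^ 2 / 2))) ∂ν := by
    refine integral_mono (integrable_finsetSum _ fun ε _ => hind ε) (integrable_const _)
      fun w => ?_
    refine le_trans (le_of_eq ?_) (card_rademacher_gt_le (fun j => f (w j)) hu)
    rw [Finset.card_filter]
    push_cast
    refine Finset.sum_congr rfl fun ε _ => ?_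
    by_cases h : w ∈ flip ε ⁻¹' B
    · rw [Set.indicator_of_mem h, if_pos ((hmem ε w).1 h)]; rfl
    · rw [Set.indicator_of_notMem h, if_neg (mt (hmem ε w).2 h)]
  rw [integral_const, probReal_univ, one_smul, ← h2] at h3
  exact le_of_mul_le_mul_left h3 (by positivity)

variable {d : ℕ} {D : Measure (EuclideanSpace ℝ (Fin d))} {M : ℝ}

theorem sd_sq (i : Fin d) :
    sd D i ^ 2 = variance (fun x : EuclideanSpace ℝ (Fin d) => x i) D :=
  Real.sq_sqrt (variance_nonneg _ _)

variable [IsProbabilityMeasure D]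

theorem memLp_coord (hM : ∀ᵐ x ∂D, ∀ i, |x i| ≤ M) (i : Fin d) :
    MemLp (fun x : EuclideanSpace ℝ (Fin d) => x i) 2 D :=
  MemLp.of_bound (by fun_prop : Measurable
    fun x : EuclideanSpace ℝ (Fin d) => x i).aestronglyMeasurable M
    (hM.mono fun x hx => hx i)

theorem sd_le (hM : ∀ᵐ x ∂D, ∀ i, |x i| ≤ M) (hM0 : 0 ≤ M) (i : Fin d) : sd D i ≤ M := by
  have h := variance_le_sq_of_bounded (μ := D) (a := -M) (b := M)
    (X := fun x : EuclideanSpace ℝ (Fin d) => x i)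
    (hM.mono fun x hx => abs_le.1 (hx i)) (memLp_coord hM i).aemeasurable
  rw [← sd_sq] at h
  have : ((M - -M) / 2) = M := by ring
  rw [this] at h
  exact abs_le_of_sq_le_sq' h hM0 |>.2

theorem abs_mean_le (hM : ∀ᵐ x ∂D, ∀ i, |x i| ≤ M) (i : Fin d) : |mean D i| ≤ M := by
  have := norm_integral_le_of_norm_le_const (μ := D) (C := M)
    (f := fun x : EuclideanSpace ℝ (Fin d) => x i) (hM.mono fun x hx => hx i)
  rw [probReal_univ, mul_one] at this
  exact this

/-- The second moment of the centered sum of a sample. -/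
theorem sum_sub_mean_second_moment (hM : ∀ᵐ x ∂D, ∀ i, |x i| ≤ M) (n : ℕ) :
    Integrable (fun x : Fin n → EuclideanSpace ℝ (Fin d) => ‖∑ j, (x j - mean D)‖ ^ 2)
      (Measure.pi fun _ => D) ∧
    ∫ x : Fin n → EuclideanSpace ℝ (Fin d), ‖∑ j, (x j - mean D)‖ ^ 2 ∂(Measure.pi fun _ => D) =
      n * ‖sd D‖ ^ 2 := by
  set X : Fin d → Fin n → EuclideanSpace ℝ (Fin d) → ℝ := fun i _ x => x i - mean D i with hX
  have hXL : ∀ i j, MemLp (X i j) 2 D := fun i j => (memLp_coord hM i).sub (memLp_const _)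
  have hint : ∀ i j, ∫ x, X i j x ∂D = 0 := fun i j => by
    rw [hX]
    simp only
    rw [integral_sub ((memLp_coord hM i).integrable (by norm_num)) (integrable_const _)]
    simp [mean]
  have hvar : ∀ i j, variance (X i j) D = sd D i ^ 2 := fun i j => by
    rw [sd_sq]
    exact variance_sub_const (memLp_coord hM i).aestronglyMeasurable _
  set P := Measure.pi fun _ : Fin n => D with hP
  have hcomp : ∀ i (j : Fin n),
      MemLp (fun x : Fin n → EuclideanSpace ℝ (Fin d) => X i j (x j)) 2 P := fun i j =>
    (hXL i j).comp_measurePreserving (measurePreserving_eval (fun _ : Fin n => D) j)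
  have hsumL : ∀ i, MemLp (∑ j, fun x : Fin n → EuclideanSpace ℝ (Fin d) => X i j (x j)) 2 P :=
    fun i => memLp_finsetSum' _ fun j _ => hcomp i j
  have hmap : ∀ j : Fin n, P.map (fun x : Fin n → EuclideanSpace ℝ (Fin d) => x j) = D :=
    fun j => (measurePreserving_eval (fun _ : Fin n => D) j).map_eq
  have hsum0 : ∀ i,
      ∫ x, (∑ j, fun x : Fin n → EuclideanSpace ℝ (Fin d) => X i j (x j)) x ∂P = 0 := fun i => by
    simp only [Finset.sum_apply]
    have hi : ∀ j ∈ Finset.univ,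
        Integrable (fun x : Fin n → EuclideanSpace ℝ (Fin d) => X i j (x j)) P := fun j _ =>
      (hcomp i j).integrable (by norm_num)
    rw [integral_finsetSum _ hi]
    refine Finset.sum_eq_zero fun j _ => ?_
    have := integral_map (μ := P) (φ := fun x : Fin n → EuclideanSpace ℝ (Fin d) => x j)
      (measurable_pi_apply j).aemeasurable
      (f := X i j) (by rw [hmap j]; exact (hXL i j).aestronglyMeasurable)
    rw [hmap j, hint i j] at this
    exact this.symm
  have hsq : ∀ i, ∫ x, (∑ j, fun x : Fin n → EuclideanSpace ℝ (Fin d) => X i j (x j)) x ^ 2 ∂P =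
      n * sd D i ^ 2 := fun i => by
    have h := variance_sum_pi (μ := fun _ : Fin n => D) (X := X i) (hXL i)
    rw [variance_of_integral_eq_zero (hsumL i).aemeasurable (hsum0 i)] at h
    simpa [hvar] using h
  have hnorm : ∀ x : Fin n → EuclideanSpace ℝ (Fin d), ‖∑ j, (x j - mean D)‖ ^ 2 =
      ∑ i, (∑ j, fun x : Fin n → EuclideanSpace ℝ (Fin d) => X i j (x j)) x ^ 2 := fun x => by
    rw [EuclideanSpace.norm_sq_eq]
    refine Finset.sum_congr rfl fun i _ => ?_
    rw [Real.norm_eq_abs, sq_abs]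
    simp [hX]
  simp only [hnorm]
  refine ⟨integrable_finsetSum _ fun i _ => (hsumL i).integrable_sq, ?_⟩
  rw [integral_finsetSum _ fun i _ => (hsumL i).integrable_sq]
  simp only [hsq]
  rw [← Finset.mul_sum, EuclideanSpace.norm_sq_eq]
  simp

/-- A dimension-free concentration inequality for the sample mean: up to the probability that
some data point is far away from the mean, the centered sum has sub-Gaussian tails. -/
theorem sum_sub_mean_tail_le (hM : ∀ᵐ x ∂D, ∀ i, |x i| ≤ M) {n : ℕ} {L u s : ℝ}
    (hu : 0 ≤ u) (hL : 0 ≤ L) (hs : 0 < s) (hs2 : 2 * (n * ‖sd D‖ ^ 2) ≤ s ^ 2)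
    (hbad : (Measure.pi fun _ : Fin n => D).real {x | ¬ ∀ j, ‖x j - mean D‖ ≤ L} ≤ 1 / 4) :
    (Measure.pi fun _ : Fin n => D).real
      {x | s + u * (2 * L * √n) < ‖∑ j, (x j - mean D)‖ ∧ ∀ j, ‖x j - mean D‖ ≤ L} ≤
      d * (8 * Real.exp (-(u ^ 2 / 2))) := by
  set P := Measure.pi fun _ : Fin n => D with hP
  set E : Set (Fin n → EuclideanSpace ℝ (Fin d)) :=
    {x | s + u * (2 * L * √n) < ‖∑ j, (x j - mean D)‖ ∧ ∀ j, ‖x j - mean D‖ ≤ L} with hE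
  set F : Set (Fin n → EuclideanSpace ℝ (Fin d)) :=
    {x | ‖∑ j, (x j - mean D)‖ ≤ s ∧ ∀ j, ‖x j - mean D‖ ≤ L} with hF
  have hall : MeasurableSet {x : Fin n → EuclideanSpace ℝ (Fin d) | ∀ j, ‖x j - mean D‖ ≤ L} := by
    rw [Set.ofPred_forall]
    exact MeasurableSet.iInter fun j => measurableSet_le (by fun_prop) measurable_const
  have hSm : Measurable fun x : Fin n → EuclideanSpace ℝ (Fin d) => ∑ j, (x j - mean D) := by
    fun_prop
  have hEm : MeasurableSet E :=
    (measurableSet_lt (measurable_const (a := s + u * (2 * L * √n))) hSm.norm).inter hall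
  have hFm : MeasurableSet F :=
    (measurableSet_le hSm.norm (measurable_const (a := s))).inter hall
  -- `F` is the event for an independent ghost sample: Chebyshev's inequality costs at most `1/2`
  -- and the far-away points at most `1/4`.
  have hFprob : 1 / 4 ≤ P.real F := by
    obtain ⟨hi, hm⟩ := sum_sub_mean_second_moment hM n
    have h1 := mul_meas_ge_le_integral_of_nonneg (ae_of_all _ fun x => by positivity) hi (s ^ 2)
    rw [hm] at h1
    have h2 : P.real {x | s ^ 2 ≤ ‖∑ j, (x j - mean D)‖ ^ 2} ≤ 1 / 2 := by
      have : s ^ 2 * P.real {x | s ^ 2 ≤ ‖∑ j, (x j - mean D)‖ ^ 2} ≤ s ^ 2 * (1 / 2) := by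
        linarith
      exact le_of_mul_le_mul_left this (by positivity)
    have h3 : Fᶜ ⊆ {x | s ^ 2 ≤ ‖∑ j, (x j - mean D)‖ ^ 2} ∪
        {x | ¬ ∀ j, ‖x j - mean D‖ ≤ L} := by
      intro x hx
      by_contra hcon
      simp only [Set.mem_union, Set.mem_ofPred_eq, not_or, not_not, not_le] at hcon
      exact hx ⟨(lt_of_pow_lt_pow_left₀ 2 hs.le hcon.1).le, hcon.2⟩
    have h4 := (measureReal_mono (μ := P) h3).trans (measureReal_union_le _ _)
    rw [probReal_compl_eq_one_sub hFm] at h4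
    linarith
  set ν := Measure.pi fun _ : Fin n => D.prod D with hν
  have hprod : P.real E * P.real F = ν.real {w | (fun j => (w j).1) ∈ E ∧ (fun j => (w j).2) ∈ F} :=
    by
    have h1 := (measurePreserving_arrowProdEquivProdArrow (EuclideanSpace ℝ (Fin d))
      (EuclideanSpace ℝ (Fin d)) (Fin n) (fun _ => D) (fun _ => D)).measure_preimage
      (s := E ×ˢ F) (hEm.prod hFm).nullMeasurableSet
    rw [Measure.prod_prod] at h1
    rw [measureReal_def, measureReal_def, ← ENNReal.toReal_mul, ← h1]
    rfl
  set f : Fin d → EuclideanSpace ℝ (Fin d) × EuclideanSpace ℝ (Fin d) → ℝ :=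
    fun i p => p.1 i - p.2 i with hf
  have hsub : {w : Fin n → EuclideanSpace ℝ (Fin d) × EuclideanSpace ℝ (Fin d) |
      (fun j => (w j).1) ∈ E ∧ (fun j => (w j).2) ∈ F} ⊆
      ⋃ i, {w | u * √(∑ j, f i (w j) ^ 2) < |∑ j, f i (w j)|} := by
    rintro w ⟨⟨h1, h2⟩, h3, h4⟩
    by_contra hcon
    simp only [Set.mem_iUnion, Set.mem_ofPred_eq, not_exists, not_lt] at hcon
    -- The self-normalized bounds of the coordinates add up to one in terms of the full norms. Thus
    -- `d` enters the probability through a union bound, but not the size of the deviation.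
    have e1 : ‖∑ j, ((w j).1 - (w j).2)‖ ^ 2 ≤ u ^ 2 * ∑ j, ‖(w j).1 - (w j).2‖ ^ 2 := by
      simp only [EuclideanSpace.norm_sq_eq]
      rw [Finset.sum_comm, Finset.mul_sum]
      refine Finset.sum_le_sum fun i _ => ?_
      have := hcon i
      have h5 : |∑ j, f i (w j)| ^ 2 ≤ (u * √(∑ j, f i (w j) ^ 2)) ^ 2 := by gcongr
      rw [mul_pow, Real.sq_sqrt (Finset.sum_nonneg fun j _ => sq_nonneg _)] at h5
      simpa [hf, Real.norm_eq_abs] using h5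
    have e2 : ∑ j, ‖(w j).1 - (w j).2‖ ^ 2 ≤ n * (2 * L) ^ 2 := by
      calc ∑ j, ‖(w j).1 - (w j).2‖ ^ 2 ≤ ∑ _j : Fin n, (2 * L) ^ 2 := by
            refine Finset.sum_le_sum fun j _ => ?_
            have h6 : (w j).1 - (w j).2 = ((w j).1 - mean D) - ((w j).2 - mean D) := by abel
            have h7 := norm_sub_le ((w j).1 - mean D) ((w j).2 - mean D)
            rw [← h6] at h7
            have h8 := h2 j
            have h9 := h4 j
            simp only at h8 h9
            gcongr
            linarith
        _ = n * (2 * L) ^ 2 := by simp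
    have e3 : ‖∑ j, ((w j).1 - (w j).2)‖ ≤ u * (2 * L * √n) := by
      refine le_of_sq_le_sq ?_ (by positivity)
      calc ‖∑ j, ((w j).1 - (w j).2)‖ ^ 2 ≤ u ^ 2 * (n * (2 * L) ^ 2) := by
            refine e1.trans ?_; gcongr
        _ = _ := by
            rw [mul_pow, mul_pow, mul_pow, Real.sq_sqrt (Nat.cast_nonneg n)]; ring
    have e4 : ∑ j, ((w j).1 - (w j).2) =
        ∑ j, ((w j).1 - mean D) - ∑ j, ((w j).2 - mean D) := by
      rw [← Finset.sum_sub_distrib]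
      exact Finset.sum_congr rfl fun j _ => by abel
    rw [e4] at e3
    have e5 := norm_sub_norm_le (∑ j, ((w j).1 - mean D)) (∑ j, ((w j).2 - mean D))
    simp only at h1 h3
    linarith
  have hν1 : ν.real {w | (fun j => (w j).1) ∈ E ∧ (fun j => (w j).2) ∈ F} ≤
      d * (2 * Real.exp (-(u ^ 2 / 2))) := by
    refine (measureReal_mono hsub).trans ((measureReal_iUnion_fintype_le _).trans ?_)
    calc ∑ i, ν.real {w | u * √(∑ j, f i (w j) ^ 2) < |∑ j, f i (w j)|}
        ≤ ∑ _i : Fin d, 2 * Real.exp (-(u ^ 2 / 2)) :=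
          Finset.sum_le_sum fun i _ => pi_symmetric_sum_tail_le D n
            (by simp only [hf]; fun_prop) (fun p => by simp [hf]) hu
      _ = _ := by simp
  rw [← hprod] at hν1
  have h0 : 0 ≤ P.real E := measureReal_nonneg
  -- Dividing by `P.real F ≥ 1/4` turns the factor `2` into `8`.
  nlinarith [mul_le_mul_of_nonneg_left hFprob h0]

end

section

/-! ### The error of the mechanism on typical samples -/

/-- The properties of a typical sample that the error analysis uses. -/
structure TypicalSample {d n : ℕ} (D : Measure (EuclideanSpace ℝ (Fin d))) (σhat : Fin d → ℝ)
    (M t W : ℝ) (x : Fin n → EuclideanSpace ℝ (Fin d)) : Prop where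
  abs_le : ∀ j i, |x j i| ≤ M
  sum_sq_le : ∀ j, ∑ i, (x j i - mean D i) ^ 2 ≤ t * ‖sd D‖ ^ 2
  sum_sq_div_le : ∀ j, ∑ i, (x j i - mean D i) ^ 2 / σhat i ≤ t * l1Norm (sd D)
  card_le : ∀ i, ((Finset.univ.filter fun j => 4 * sd D i < |x j i - mean D i|).card : ℝ) ≤ n / 4
  norm_sum_le : ‖∑ j, (x j - mean D)‖ ≤ W

variable {d n : ℕ} {D : Measure (EuclideanSpace ℝ (Fin d))} {σhat : Fin d → ℝ}
  {M t W u ρ₁ ρ₂ ρ₃ k N : ℝ} {x : Fin n → EuclideanSpace ℝ (Fin d)}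

theorem l1Norm_sd : l1Norm (sd D) = ∑ i, sd D i :=
  Finset.sum_congr rfl fun _ _ => abs_of_nonneg (Real.sqrt_nonneg _)

theorem norm_le_l1Norm (v : EuclideanSpace ℝ (Fin d)) : ‖v‖ ≤ l1Norm v := by
  have h0 : 0 ≤ l1Norm v := Finset.sum_nonneg fun i _ => abs_nonneg _
  refine le_of_sq_le_sq ?_ h0
  rw [EuclideanSpace.norm_sq_eq]
  simp only [Real.norm_eq_abs]
  unfold l1Norm
  exact Finset.sum_sq_le_sq_sum_of_nonneg fun i _ => abs_nonneg _

theorem one_le_l1Norm_sd (hd : 1 ≤ d) (hσ : ∀ i, 1 ≤ sd D i) : 1 ≤ l1Norm (sd D) := by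
  rw [l1Norm_sd]
  exact (hσ ⟨0, hd⟩).trans (Finset.single_le_sum (f := fun i => sd D i)
    (fun i _ => zero_le_one.trans (hσ i)) (Finset.mem_univ _))

theorem IsSdEstimate.sum_le (h : IsSdEstimate (sd D) σhat) :
    ∑ i, σhat i ≤ 2 * l1Norm (sd D) := by
  obtain rfl | hd := d.eq_zero_or_pos
  · simp [l1Norm]
  have hd' : (0 : ℝ) < d := by exact_mod_cast hd
  calc ∑ i, σhat i ≤ ∑ i, (sd D i + l1Norm (sd D) / d) :=
        Finset.sum_le_sum fun i _ => (h i).2.le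
    _ = 2 * l1Norm (sd D) := by
        rw [Finset.sum_add_distrib, ← l1Norm_sd, Finset.sum_const, Finset.card_univ,
          Fintype.card_fin, nsmul_eq_mul]
        field_simp; norm_num

theorem IsSdEstimate.le_two_mul (h : IsSdEstimate (sd D) σhat) (hM : ∀ i, sd D i ≤ M) (i : Fin d) :
    σhat i ≤ 2 * M := by
  have hd' : (0 : ℝ) < d := by exact_mod_cast i.pos
  have h1 : l1Norm (sd D) / d ≤ M := by
    rw [div_le_iff₀ hd', l1Norm_sd]
    calc ∑ i, sd D i ≤ ∑ _i : Fin d, M := Finset.sum_le_sum fun i _ => hM i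
      _ = M * d := by simp [mul_comm]
  linarith [(h i).2, hM i]

/-- The outlier threshold contributes `4 σ i`; the search accuracy `1` is absorbed by `1 ≤ σ i`. -/
theorem abs_roughMean_sub_le (hn : 0 < n) (hM : 1 ≤ M) (hσ : ∀ i, 1 ≤ sd D i)
    (hμ : ∀ i, |mean D i| ≤ M) (hx : TypicalSample D σhat M t W x)
    (hu : √((stepsMedian M : ℕ) / (2 * (ρ₁ / d))) * u ≤ n / 8)
    {g : Fin d → Fin (stepsMedian M) → ℝ} (hg : ∀ i s, |g i s| ≤ u) (i : Fin d) :
    |roughMean M ρ₁ x g i - mean D i| ≤ 5 * sd D i := by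
  have h := abs_privQuantile_median_sub_le hn (R := M) (τ := 1) (ρ := ρ₁ / d) (by linarith)
    one_pos (hμ i) (by linarith [hσ i] : 0 ≤ 4 * sd D i) (hx.card_le i) hu (hg i)
  have h2 : |roughMean M ρ₁ x g i - mean D i| ≤ 4 * sd D i + 1 := h
  linarith [hσ i]

theorem abs_roughMean_le (hM : 0 ≤ M) (g : Fin d → Fin (stepsMedian M) → ℝ) (i : Fin d) :
    |roughMean M ρ₁ x g i| ≤ M :=
  abs_privQuantile_le hM _ _ _ _ _

theorem norm_rescale_sq (hσ : ∀ i, 0 ≤ σhat i) (c y : EuclideanSpace ℝ (Fin d)) :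
    ‖rescale σhat c y‖ ^ 2 = ∑ i, (y i - c i) ^ 2 / σhat i := by
  rw [EuclideanSpace.norm_sq_eq]
  refine Finset.sum_congr rfl fun i _ => ?_
  rw [Real.norm_eq_abs, sq_abs, rescale, div_pow, Real.sq_sqrt (hσ i)]

/-- The error of the mechanism on a typical sample, as a function of the final noise `g`. -/
theorem norm_plan_sub_le (hn : 0 < n) (hd : 1 ≤ d) (hM : 1 ≤ M) (hσ : ∀ i, 1 ≤ sd D i)
    (hσM : ∀ i, sd D i ≤ M) (hμ : ∀ i, |mean D i| ≤ M) (hσhat : IsSdEstimate (sd D) σhat)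
    (ht : 0 ≤ t) (hx : TypicalSample D σhat M t W x)
    (hu₁ : √((stepsMedian M : ℕ) / (2 * (ρ₁ / d))) * u ≤ n / 8)
    (hu₂ : √((stepsClip d M : ℕ) / (2 * ρ₂)) * u ≤ N) (hN : 0 ≤ N) (hNk : N ≤ k)
    (hkn : k + N < n) (hρ₃ : 0 < ρ₃) {ω : Noise d (stepsMedian M) (stepsClip d M)}
    (hω : NoiseBounded u ω) (g : Fin d → ℝ) :
    ‖plan M k ρ₁ ρ₂ ρ₃ σhat x (ω.1, ω.2.1, g) - mean D‖ ≤
      (W + (k + N) * ((√t + 5) * ‖sd D‖)) / n + 2 +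
        √(8 * (2 * t + 50) * l1Norm (sd D) / ρ₃) / n * ‖unscale σhat (WithLp.toLp 2 g)‖ := by
  have hM0 : 0 < M := by linarith
  have hd' : (1 : ℝ) ≤ d := by exact_mod_cast hd
  have hσhat1 : ∀ i, 1 ≤ σhat i := fun i => (hσ i).trans (hσhat i).1
  have hσhat0 : ∀ i, 0 < σhat i := fun i => zero_lt_one.trans_le (hσhat1 i)
  have hl1 : 1 ≤ l1Norm (sd D) := one_le_l1Norm_sd hd hσ
  set c := roughMean M ρ₁ x ω.1 with hc
  have hcμ : ∀ i, |c i - mean D i| ≤ 5 * sd D i :=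
    abs_roughMean_sub_le hn hM hσ hμ hx hu₁ hω.1
  have hcμ2 : ∀ i, (c i - mean D i) ^ 2 ≤ 25 * sd D i ^ 2 := fun i => by
    have := hcμ i
    calc (c i - mean D i) ^ 2 = |c i - mean D i| ^ 2 := (sq_abs _).symm
      _ ≤ (5 * sd D i) ^ 2 := by gcongr
      _ = 25 * sd D i ^ 2 := by ring
  have hcnorm : ‖c - mean D‖ ≤ 5 * ‖sd D‖ := by
    refine le_of_sq_le_sq ?_ (by positivity)
    rw [mul_pow, EuclideanSpace.norm_sq_eq, EuclideanSpace.norm_sq_eq, Finset.mul_sum]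
    refine Finset.sum_le_sum fun i _ => ?_
    rw [Real.norm_eq_abs, Real.norm_eq_abs, sq_abs, sq_abs]
    exact (hcμ2 i).trans_eq (by norm_num)
  have hxμ : ∀ j, ‖x j - mean D‖ ≤ √t * ‖sd D‖ := fun j => by
    refine le_of_sq_le_sq ?_ (by positivity)
    rw [mul_pow, Real.sq_sqrt ht, EuclideanSpace.norm_sq_eq (x j - mean D)]
    simpa [Real.norm_eq_abs] using hx.sum_sq_le j
  have hxc : ∀ j, ‖x j - c‖ ≤ (√t + 5) * ‖sd D‖ := fun j => by
    have h := norm_sub_le (x j - mean D) (c - mean D)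
    rw [sub_sub_sub_cancel_right] at h
    linarith [hxμ j]
  set y : Fin n → EuclideanSpace ℝ (Fin d) := fun j => rescale σhat c (x j) with hy
  -- From `(x - c)² ≤ 2 (x - μ)² + 2 (c - μ)²` with `|c - μ| ≤ 5 σ`, where `σ² / σ̂ ≤ σ` reduces the
  -- second part to `50 ‖σ‖₁`.
  set U := √((2 * t + 50) * l1Norm (sd D)) with hU
  have hU2 : U ^ 2 = (2 * t + 50) * l1Norm (sd D) := Real.sq_sqrt (by positivity)
  have hU0 : 0 ≤ U := Real.sqrt_nonneg _
  have hyU : ∀ j, ‖y j‖ ≤ U := fun j => by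
    refine le_of_sq_le_sq ?_ hU0
    rw [hU2, hy, norm_rescale_sq fun i => (hσhat0 i).le]
    have h1 : ∀ i, (x j i - c i) ^ 2 / σhat i ≤
        2 * ((x j i - mean D i) ^ 2 / σhat i) + 50 * sd D i := fun i => by
      have h2 : (x j i - c i) ^ 2 ≤ 2 * (x j i - mean D i) ^ 2 + 50 * sd D i ^ 2 := by
        nlinarith [hcμ2 i, sq_nonneg ((x j i - mean D i) + (c i - mean D i))]
      have h3 : sd D i ^ 2 / σhat i ≤ sd D i := by
        rw [div_le_iff₀ (hσhat0 i), sq]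
        exact mul_le_mul_of_nonneg_left (hσhat i).1 (by linarith [hσ i])
      calc (x j i - c i) ^ 2 / σhat i
          ≤ (2 * (x j i - mean D i) ^ 2 + 50 * sd D i ^ 2) / σhat i := by
            have := (hσhat0 i).le; gcongr
        _ = 2 * ((x j i - mean D i) ^ 2 / σhat i) + 50 * (sd D i ^ 2 / σhat i) := by ring
        _ ≤ _ := by gcongr
    calc ∑ i, (x j i - c i) ^ 2 / σhat i
        ≤ ∑ i, (2 * ((x j i - mean D i) ^ 2 / σhat i) + 50 * sd D i) :=
          Finset.sum_le_sum fun i _ => h1 i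
      _ = 2 * ∑ i, (x j i - mean D i) ^ 2 / σhat i + 50 * l1Norm (sd D) := by
          rw [Finset.sum_add_distrib, ← Finset.mul_sum, ← Finset.mul_sum, l1Norm_sd]
      _ ≤ 2 * (t * l1Norm (sd D)) + 50 * l1Norm (sd D) := by gcongr; exact hx.sum_sq_div_le j
      _ = _ := by ring
  have hyR : ∀ j, ‖y j‖ ≤ clipRange d M := fun j => by
    refine le_of_sq_le_sq ?_ (by positivity)
    rw [hy, norm_rescale_sq fun i => (hσhat0 i).le, mul_pow, Real.sq_sqrt (Nat.cast_nonneg d)]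
    calc ∑ i, (x j i - c i) ^ 2 / σhat i ≤ ∑ _i : Fin d, (2 * M) ^ 2 := by
          refine Finset.sum_le_sum fun i _ => ?_
          have h2 : |x j i - c i| ≤ 2 * M := by
            have h3 := abs_roughMean_le (ρ₁ := ρ₁) (x := x) hM0.le ω.1 i
            have h4 := abs_sub (x j i) (c i)
            linarith [hx.abs_le j i]
          calc (x j i - c i) ^ 2 / σhat i ≤ (x j i - c i) ^ 2 :=
                div_le_self (sq_nonneg _) (hσhat1 i)
            _ = |x j i - c i| ^ 2 := (sq_abs _).symm
            _ ≤ (2 * M) ^ 2 := by gcongr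
      _ = (2 * M) ^ 2 * d := by simp [mul_comm]
  have hR0 : 0 < clipRange d M := by
    have : 0 < √(d : ℝ) := Real.sqrt_pos.2 (by linarith)
    positivity
  have hclip := privQuantile_upper hn (R := clipRange d M) (τ := 1 / M) (ρ := ρ₂)
    (z := fun j => ‖y j‖) hR0 (by positivity) (fun j => norm_nonneg _) hyR hyU hU0 hu₂ hN hNk hkn
    hω.2.1
  set C := clipRadius M k ρ₂ y ω.2.1 with hC
  obtain ⟨hC1, r, hr0, hrC, hrN⟩ : C ≤ U + 1 / M ∧ ∃ r, 0 ≤ r ∧ r ≤ C + 1 / M ∧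
    ((Finset.univ.filter fun j => r < ‖y j‖).card : ℝ) ≤ k + N := hclip
  have hτ1 : 1 / M ≤ 1 := by rw [div_le_one hM0]; exact hM
  have hU1 : 1 ≤ U := by
    refine le_of_sq_le_sq ?_ hU0
    rw [hU2]
    nlinarith
  -- The accuracy `1 / M ≤ 1 ≤ U` is absorbed into the radius; the lower bound uses `C ≥ r - 1 / M ≥
  -- -1`.
  have hCabs : C ^ 2 ≤ (2 * U) ^ 2 := by
    rw [sq_le_sq, abs_of_nonneg (by linarith : 0 ≤ 2 * U), abs_le]
    constructor <;> linarith
  have hlast := norm_release_sub_le (ρ₃ := ρ₃) (μ := mean D) hn hσhat0 (b := 2 * M)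
    (hσhat.le_two_mul hσM) (τ := 1 / M) (by positivity) hr0 hrC hxc hrN g
  -- The accuracy `1 / M` of the radius is measured in rescaled norm; unscaling costs at most
  -- `√(2M)`.
  have hbias : 1 / M * √(2 * M) ≤ 2 := by
    have h1 : √(2 * M) ≤ 2 * M := by
      rw [Real.sqrt_le_left (by linarith)]; nlinarith
    calc 1 / M * √(2 * M) ≤ 1 / M * (2 * M) := by gcongr
      _ = 2 := by field_simp
  have hnoise : √(2 * C ^ 2 / ρ₃) ≤ √(8 * (2 * t + 50) * l1Norm (sd D) / ρ₃) := by
    apply Real.sqrt_le_sqrt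
    refine div_le_div_of_nonneg_right ?_ hρ₃.le
    calc 2 * C ^ 2 ≤ 2 * (2 * U) ^ 2 := by gcongr
      _ = _ := by rw [mul_pow, hU2]; ring
  rw [plan_eq_release]
  refine hlast.trans ?_
  have hx0 := hx.norm_sum_le
  gcongr

/-! ### The size of the rescaled Gaussian noise -/

theorem norm_unscale_sq (hσ : ∀ i, 0 ≤ σhat i) (g : Fin d → ℝ) :
    ‖unscale σhat (WithLp.toLp 2 g)‖ ^ 2 = ∑ i, σhat i * g i ^ 2 := by
  rw [EuclideanSpace.norm_sq_eq]
  refine Finset.sum_congr rfl fun i _ => ?_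
  rw [Real.norm_eq_abs, sq_abs, unscale, mul_pow, Real.sq_sqrt (hσ i)]

theorem norm_unscale_le_of_abs_le (hσ : ∀ i, 0 ≤ σhat i) {b : ℝ} (hb : ∑ i, σhat i ≤ b)
    (hu : 0 ≤ u) {g : Fin d → ℝ} (hg : ∀ i, |g i| ≤ u) :
    ‖unscale σhat (WithLp.toLp 2 g)‖ ≤ √b * u := by
  refine le_of_sq_le_sq ?_ (by positivity)
  have hb0 : 0 ≤ b := (Finset.sum_nonneg fun i _ => hσ i).trans hb
  rw [norm_unscale_sq hσ, mul_pow, Real.sq_sqrt hb0]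
  calc ∑ i, σhat i * g i ^ 2 ≤ ∑ i, σhat i * u ^ 2 := by
        refine Finset.sum_le_sum fun i _ => mul_le_mul_of_nonneg_left ?_ (hσ i)
        rw [← sq_abs]
        have := hg i
        gcongr
    _ ≤ b * u ^ 2 := by rw [← Finset.sum_mul]; gcongr

theorem integral_sq_stdNormal (i : Fin d) :
    Integrable (fun g : Fin d → ℝ => g i ^ 2) (stdNormal d) ∧
      ∫ g : Fin d → ℝ, g i ^ 2 ∂(stdNormal d) = 1 := by
  have hmap := measurePreserving_eval (fun _ : Fin d => gaussianReal 0 1) i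
  have hL : MemLp id 2 (gaussianReal 0 1) := by
    simpa using memLp_id_gaussianReal (μ := 0) (v := 1) 2
  have h1 : ∫ z, z ^ 2 ∂(gaussianReal 0 1) = 1 := by
    have := variance_of_integral_eq_zero (μ := gaussianReal 0 1) (X := id)
      measurable_id.aemeasurable (by simp)
    rw [variance_id_gaussianReal] at this
    simpa using this.symm
  constructor
  · exact hmap.integrable_comp_of_integrable (g := fun z : ℝ => z ^ 2) hL.integrable_sq
  · rw [← h1]
    unfold stdNormal
    conv_rhs => rw [← hmap.map_eq]
    rw [integral_map hmap.measurable.aemeasurable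
      (by fun_prop : Measurable fun z : ℝ => z ^ 2).aestronglyMeasurable]

/-- The inequality `z ≤ (√b + z² / √b) / 2` reduces the mean of the norm to its second moment `∑ i,
σhat i ≤ b`. -/
theorem lintegral_norm_unscale_le (hσ : ∀ i, 0 ≤ σhat i) {b : ℝ} (hb0 : 0 < b)
    (hb : ∑ i, σhat i ≤ b) {r s : ℝ} (hr : 0 ≤ r) (hs : 0 ≤ s) :
    ∫⁻ g, ENNReal.ofReal (r + s * ‖unscale σhat (WithLp.toLp 2 g)‖) ∂(stdNormal d) ≤
      ENNReal.ofReal (r + s * √b) := by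
  have hm : 0 < √b := Real.sqrt_pos.2 hb0
  set F : (Fin d → ℝ) → ℝ := fun g => r + s * ((√b + (∑ i, σhat i * g i ^ 2) / √b) / 2) with hF
  have hsum : Integrable (fun g : Fin d → ℝ => ∑ i, σhat i * g i ^ 2) (stdNormal d) :=
    integrable_finsetSum _ fun i _ => (integral_sq_stdNormal i).1.const_mul _
  have hsum1 : ∫ g : Fin d → ℝ, ∑ i, σhat i * g i ^ 2 ∂(stdNormal d) = ∑ i, σhat i := by
    rw [integral_finsetSum _ fun i _ => (integral_sq_stdNormal i).1.const_mul _]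
    refine Finset.sum_congr rfl fun i _ => ?_
    rw [integral_const_mul, (integral_sq_stdNormal i).2, mul_one]
  have hle : ∀ g, r + s * ‖unscale σhat (WithLp.toLp 2 g)‖ ≤ F g := fun g => by
    have : ‖unscale σhat (WithLp.toLp 2 g)‖ ≤ (√b + (∑ i, σhat i * g i ^ 2) / √b) / 2 := by
      rw [← norm_unscale_sq hσ]
      set z := ‖unscale σhat (WithLp.toLp 2 g)‖
      have h1 : 0 ≤ (z - √b) ^ 2 / √b := by positivity
      have h2 : (z - √b) ^ 2 / √b = z ^ 2 / √b - 2 * z + √b := by field_simp; ring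
      linarith
    simp only [hF]
    gcongr
  have hi1 : Integrable (fun g : Fin d → ℝ => (√b + (∑ i, σhat i * g i ^ 2) / √b) / 2)
      (stdNormal d) := ((integrable_const _).add (hsum.div_const _)).div_const _
  have hFi : Integrable F (stdNormal d) := (integrable_const r).add (hi1.const_mul s)
  have hF0 : ∀ g, 0 ≤ F g := fun g => (by positivity : 0 ≤ r + s * _).trans (hle g)
  refine (lintegral_mono fun g => ENNReal.ofReal_le_ofReal (hle g)).trans ?_
  rw [← ofReal_integral_eq_lintegral_ofReal hFi (ae_of_all _ hF0)]
  apply ENNReal.ofReal_le_ofReal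
  have e : ∫ g, F g ∂(stdNormal d) = r + s * ((√b + (∑ i, σhat i) / √b) / 2) := by
    simp only [hF]
    rw [integral_add (integrable_const _) (hi1.const_mul s), integral_const_mul, integral_div,
      integral_add (integrable_const _) (hsum.div_const _), integral_div, hsum1]
    simp
  rw [e]
  have h3 : (∑ i, σhat i) / √b ≤ √b := by
    rw [div_le_iff₀ hm, Real.mul_self_sqrt hb0.le]; exact hb
  gcongr
  linarith

end

section

/-! ### Samples and noise are typical with high probability -/

variable {d n : ℕ} {D : Measure (EuclideanSpace ℝ (Fin d))} [IsProbabilityMeasure D]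
  {σhat : Fin d → ℝ} {M t W u ρ₁ ρ₂ ρ₃ k N B β δ : ℝ}

theorem measureReal_outlier_le (hM : ∀ᵐ x ∂D, ∀ i, |x i| ≤ M) {i : Fin d} (hσ : 0 < sd D i) :
    D.real {x | 4 * sd D i < |x i - mean D i|} ≤ 1 / 16 := by
  have h := meas_ge_le_variance_div_sq (memLp_coord hM i) (c := 4 * sd D i) (by positivity)
  rw [← sd_sq] at h
  have e : sd D i ^ 2 / (4 * sd D i) ^ 2 = 1 / 16 := by field_simp; norm_num
  rw [e] at h
  refine ENNReal.toReal_le_of_le_ofReal (by norm_num) (le_trans (measure_mono ?_) h)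
  intro x (hx : 4 * sd D i < |x i - mean D i|)
  exact hx.le

/-- A union bound over five events. The deviation of the sum is controlled only when all points lie
within `√t ‖σ‖₂` of the mean, and the exceptional event is already among the others. -/
theorem pi_not_typicalSample_le (hn : 0 < n) (hd : 1 ≤ d) (hM : ∀ᵐ x ∂D, ∀ i, |x i| ≤ M)
    (hσ : ∀ i, 1 ≤ sd D i) (ht : 0 ≤ t) (hu : 0 ≤ u)
    (h₁ : D.real {x | t * ‖sd D‖ ^ 2 < ∑ i, (x i - mean D i) ^ 2} ≤ δ)
    (h₂ : D.real {x | t * l1Norm (sd D) < ∑ i, (x i - mean D i) ^ 2 / σhat i} ≤ δ)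
    (hδ : n * δ ≤ 1 / 4) :
    (Measure.pi fun _ : Fin n => D).real {x | ¬ TypicalSample D σhat M t
      (2 * (√n * ‖sd D‖) + u * (2 * (√t * ‖sd D‖) * √n)) x} ≤
      2 * (n * δ) + d * Real.exp (-(n / 8)) + d * (8 * Real.exp (-(u ^ 2 / 2))) := by
  set P := Measure.pi fun _ : Fin n => D with hP
  set L := √t * ‖sd D‖ with hL
  have hn' : (0 : ℝ) < n := by exact_mod_cast hn
  have hσpos : 0 < ‖sd D‖ := by
    rw [norm_pos_iff]
    intro h0
    have := hσ ⟨0, hd⟩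
    rw [h0] at this
    simp at this
    linarith
  have hm0 : MeasurableSet {x : EuclideanSpace ℝ (Fin d) | ¬ ∀ i, |x i| ≤ M} := by
    refine MeasurableSet.compl (s := {x : EuclideanSpace ℝ (Fin d) | ∀ i, |x i| ≤ M}) ?_
    rw [Set.ofPred_forall]
    exact MeasurableSet.iInter fun i => measurableSet_le (by fun_prop) measurable_const
  have hm1 : MeasurableSet
      {x : EuclideanSpace ℝ (Fin d) | t * ‖sd D‖ ^ 2 < ∑ i, (x i - mean D i) ^ 2} :=
    measurableSet_lt measurable_const (by fun_prop)
  have hm2 : MeasurableSet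
      {x : EuclideanSpace ℝ (Fin d) | t * l1Norm (sd D) < ∑ i, (x i - mean D i) ^ 2 / σhat i} :=
    measurableSet_lt measurable_const (by fun_prop)
  have hm3 : ∀ i, MeasurableSet
      {x : EuclideanSpace ℝ (Fin d) | 4 * sd D i < |x i - mean D i|} := fun i =>
    measurableSet_lt measurable_const (by fun_prop)
  set E0 : Set (Fin n → EuclideanSpace ℝ (Fin d)) := {x | ∃ j, x j ∈ {y | ¬ ∀ i, |y i| ≤ M}}
    with hE0
  set E1 : Set (Fin n → EuclideanSpace ℝ (Fin d)) :=
    {x | ∃ j, x j ∈ {y | t * ‖sd D‖ ^ 2 < ∑ i, (y i - mean D i) ^ 2}} with hE1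
  set E2 : Set (Fin n → EuclideanSpace ℝ (Fin d)) :=
    {x | ∃ j, x j ∈ {y | t * l1Norm (sd D) < ∑ i, (y i - mean D i) ^ 2 / σhat i}} with hE2
  set E3 : Set (Fin n → EuclideanSpace ℝ (Fin d)) :=
    ⋃ i, {x | (n : ℝ) / 4 <
      ((Finset.univ.filter fun j => 4 * sd D i < |x j i - mean D i|).card : ℝ)} with hE3
  set E4 : Set (Fin n → EuclideanSpace ℝ (Fin d)) :=
    {x | 2 * (√n * ‖sd D‖) + u * (2 * L * √n) < ‖∑ j, (x j - mean D)‖ ∧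
      ∀ j, ‖x j - mean D‖ ≤ L} with hE4
  have p0 : P.real E0 = 0 := by
    refine le_antisymm ((pi_exists_mem_le D hm0).trans_eq ?_) measureReal_nonneg
    have : D {x | ¬ ∀ i, |x i| ≤ M} = 0 := ae_iff.1 hM
    rw [measureReal_def, this]; simp
  have p1 : P.real E1 ≤ n * δ := (pi_exists_mem_le D hm1).trans (by gcongr)
  have p2 : P.real E2 ≤ n * δ := (pi_exists_mem_le D hm2).trans (by gcongr)
  have p3 : P.real E3 ≤ d * Real.exp (-(n / 8)) := by
    refine (measureReal_iUnion_fintype_le _).trans ?_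
    refine (Finset.sum_le_sum fun i _ => pi_card_gt_le D (hm3 i)
      (measureReal_outlier_le hM (by linarith [hσ i]))).trans_eq ?_
    simp
  have hnorm : ∀ y : EuclideanSpace ℝ (Fin d), ¬ ‖y - mean D‖ ≤ L →
      t * ‖sd D‖ ^ 2 < ∑ i, (y i - mean D i) ^ 2 := fun y hy => by
    have h0 : 0 ≤ L := by positivity
    have h : L ^ 2 < ‖y - mean D‖ ^ 2 := by
      have := not_le.1 hy
      gcongr
    rw [hL, mul_pow, Real.sq_sqrt ht, EuclideanSpace.norm_sq_eq (y - mean D)] at h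
    simpa [Real.norm_eq_abs] using h
  have p4 : P.real E4 ≤ d * (8 * Real.exp (-(u ^ 2 / 2))) := by
    refine sum_sub_mean_tail_le hM hu (by positivity) (by positivity) ?_ ?_
    · rw [mul_pow, mul_pow, Real.sq_sqrt hn'.le]
      nlinarith [mul_nonneg hn'.le (sq_nonneg ‖sd D‖)]
    · refine (measureReal_mono (s₂ := E1) ?_).trans (p1.trans hδ)
      intro x hx
      obtain ⟨j, hj⟩ := not_forall.1 hx
      exact ⟨j, hnorm _ hj⟩
  have hsub : {x | ¬ TypicalSample D σhat M t
      (2 * (√n * ‖sd D‖) + u * (2 * L * √n)) x} ⊆ E0 ∪ E1 ∪ E2 ∪ E3 ∪ E4 := by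
    intro x hx
    by_contra hcon
    simp only [Set.mem_union, not_or] at hcon
    obtain ⟨⟨⟨⟨c0, c1⟩, c2⟩, c3⟩, c4⟩ := hcon
    simp only [hE0, Set.mem_ofPred_eq, not_exists, not_not] at c0
    simp only [hE1, Set.mem_ofPred_eq, not_exists] at c1
    simp only [hE2, Set.mem_ofPred_eq, not_exists, not_lt] at c2
    simp only [hE3, Set.mem_iUnion, Set.mem_ofPred_eq, not_exists, not_lt] at c3
    refine hx ⟨c0, fun j => not_lt.1 (c1 j), c2, c3, ?_⟩
    by_contra h
    exact c4 ⟨not_le.1 h, fun j => by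
      by_contra hj
      exact c1 j (hnorm _ hj)⟩
  have q1 := measureReal_mono (μ := P) hsub
  have q2 := measureReal_union_le (μ := P) (E0 ∪ E1 ∪ E2 ∪ E3) E4
  have q3 := measureReal_union_le (μ := P) (E0 ∪ E1 ∪ E2) E3
  have q4 := measureReal_union_le (μ := P) (E0 ∪ E1) E2
  have q5 := measureReal_union_le (μ := P) E0 E1
  linarith

/-- Accuracy of the mechanism from the probabilities of atypical samples and noise. -/
theorem planAccurate_of_typical (hn : 0 < n) (hd : 1 ≤ d) (hM1 : 1 ≤ M)
    (hM : ∀ᵐ x ∂D, ∀ i, |x i| ≤ M) (hσ : ∀ i, 1 ≤ sd D i) (hσhat : IsSdEstimate (sd D) σhat)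
    (ht : 0 ≤ t) (hW : 0 ≤ W) (hu : 1 ≤ u)
    (hu₁ : √((stepsMedian M : ℕ) / (2 * (ρ₁ / d))) * u ≤ n / 8)
    (hu₂ : √((stepsClip d M : ℕ) / (2 * ρ₂)) * u ≤ N) (hN : 0 ≤ N) (hNk : N ≤ k)
    (hkn : k + N < n) (hρ₃ : 0 < ρ₃)
    (hprob : (Measure.pi fun _ : Fin n => D).real {x | ¬ TypicalSample D σhat M t W x} +
      (noiseLaw d (stepsMedian M) (stepsClip d M)).real {ω | ¬ NoiseBounded u ω} ≤ β)
    (hB : (W + (k + N) * ((√t + 5) * ‖sd D‖)) / n + 2 +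
      √(8 * (2 * t + 50) * l1Norm (sd D) / ρ₃) / n * (√(2 * l1Norm (sd D)) * u) ≤ B) :
    PlanAccurate n M k ρ₁ ρ₂ ρ₃ σhat D B β := by
  set P := Measure.pi fun _ : Fin n => D with hP
  set ν := noiseLaw d (stepsMedian M) (stepsClip d M) with hν
  set r := (W + (k + N) * ((√t + 5) * ‖sd D‖)) / n + 2 with hr
  set s := √(8 * (2 * t + 50) * l1Norm (sd D) / ρ₃) / n with hs
  have hk0 : 0 ≤ k := hN.trans hNk
  have hr0 : 0 ≤ r := by positivity
  have hs0 : 0 ≤ s := by positivity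
  have hl1 : 1 ≤ l1Norm (sd D) := one_le_l1Norm_sd hd hσ
  have hσhat0 : ∀ i, 0 ≤ σhat i := fun i => zero_le_one.trans ((hσ i).trans (hσhat i).1)
  have herr : ∀ x ω, TypicalSample D σhat M t W x → NoiseBounded u ω → ∀ g : Fin d → ℝ,
      ‖plan M k ρ₁ ρ₂ ρ₃ σhat x (ω.1, ω.2.1, g) - mean D‖ ≤
        r + s * ‖unscale σhat (WithLp.toLp 2 g)‖ := fun x ω hx hω g =>
    norm_plan_sub_le hn hd hM1 hσ (sd_le hM (by linarith)) (abs_mean_le hM) hσhat ht hx hu₁ hu₂ hN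
      hNk hkn hρ₃ hω g
  have hbad : (P.prod ν) ({x | ¬ TypicalSample D σhat M t W x} ×ˢ Set.univ ∪
      Set.univ ×ˢ {ω | ¬ NoiseBounded u ω}) ≤ ENNReal.ofReal β := by
    refine (measure_union_le _ _).trans ?_
    -- The product formula for rectangles holds for arbitrary sets, so neither bad event has to be
    -- shown measurable.
    rw [Measure.prod_prod, Measure.prod_prod, measure_univ, measure_univ, mul_one, one_mul,
      ← ofReal_measureReal, ← ofReal_measureReal,
      ← ENNReal.ofReal_add measureReal_nonneg measureReal_nonneg]
    exact ENNReal.ofReal_le_ofReal hprob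
  have hsplit : ∀ p : (Fin n → EuclideanSpace ℝ (Fin d)) × Noise d (stepsMedian M) (stepsClip d M),
      p ∉ {x | ¬ TypicalSample D σhat M t W x} ×ˢ Set.univ ∪
        Set.univ ×ˢ {ω | ¬ NoiseBounded u ω} →
      TypicalSample D σhat M t W p.1 ∧ NoiseBounded u p.2 := fun p hp => by
    simp only [Set.mem_union, Set.mem_prod, Set.mem_univ, and_true, true_and, Set.mem_ofPred_eq,
      not_or, not_not] at hp
    exact hp
  have hb : s * √(2 * l1Norm (sd D)) ≤ s * (√(2 * l1Norm (sd D)) * u) := by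
    gcongr
    exact le_mul_of_one_le_right (Real.sqrt_nonneg _) hu
  constructor
  · refine (measure_mono fun p hp => ?_).trans hbad
    by_contra hcon
    obtain ⟨h1, h2⟩ := hsplit p hcon
    have h3 := herr _ _ h1 h2 p.2.2.2
    have h4 := norm_unscale_le_of_abs_le hσhat0 hσhat.sum_le (by linarith) h2.2.2
    have h5 : B < ‖plan M k ρ₁ ρ₂ ρ₃ σhat p.1 p.2 - mean D‖ := hp
    have h6 := mul_le_mul_of_nonneg_left h4 hs0
    exact absurd (h3.trans (by linarith)) (not_le.2 h5)
  · refine (measure_mono fun p hp => ?_).trans hbad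
    by_contra hcon
    obtain ⟨h1, h2⟩ := hsplit p hcon
    refine absurd (Set.mem_ofPred_eq.mp hp) (not_lt.2 ?_)
    calc ∫⁻ g, ‖plan M k ρ₁ ρ₂ ρ₃ σhat p.1 (p.2.1, p.2.2.1, g) - mean D‖ₑ ∂(stdNormal d)
        ≤ ∫⁻ g, ENNReal.ofReal (r + s * ‖unscale σhat (WithLp.toLp 2 g)‖) ∂(stdNormal d) := by
          refine lintegral_mono fun g => ?_
          rw [← ofReal_norm]
          exact ENNReal.ofReal_le_ofReal (herr _ _ h1 h2 g)
      _ ≤ ENNReal.ofReal (r + s * √(2 * l1Norm (sd D))) :=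
          lintegral_norm_unscale_le hσhat0 (by linarith) hσhat.sum_le hr0 hs0
      _ ≤ ENNReal.ofReal B := ENNReal.ofReal_le_ofReal (by linarith)

end

section

/-! ### Numerical estimates -/

theorem searchSteps_le {R τ : ℝ} (h : 1 ≤ R / τ) :
    (searchSteps R τ : ℝ) ≤ 1 + 2 * Real.log (R / τ) := by
  have hlog : 0 ≤ Real.log (R / τ) := Real.log_nonneg h
  have h0 : 0 ≤ Real.logb 2 (R / τ) := Real.logb_nonneg one_lt_two h
  have h1 := (Nat.ceil_lt_add_one h0).le
  have h2 : Real.logb 2 (R / τ) ≤ 2 * Real.log (R / τ) := by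
    have h3 := Real.log_two_gt_d9
    rw [Real.logb, div_le_iff₀ (by linarith)]
    nlinarith
  unfold searchSteps
  linarith

variable {d n : ℕ} {M β ρ : ℝ}

theorem logFactor_bounds (hd : 1 ≤ d) (hM : 1 ≤ M) (hβ : 0 < β) (hβ1 : β < 1) :
    0 ≤ Real.log d ∧ 0 ≤ Real.log M ∧ 0 ≤ Real.log (1 / β) ∧ 1 ≤ logFactor d M β := by
  have hd' : (1 : ℝ) ≤ d := by exact_mod_cast hd
  have h1 := Real.log_nonneg hd'
  have h2 := Real.log_nonneg hM
  have h3 : 0 ≤ Real.log (1 / β) := Real.log_nonneg (by rw [le_div_iff₀ hβ]; linarith)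
  refine ⟨h1, h2, h3, ?_⟩
  unfold logFactor
  linarith

theorem stepsMedian_le (hM : 1 ≤ M) : (stepsMedian M : ℝ) ≤ 1 + 2 * Real.log M := by
  have := searchSteps_le (R := M) (τ := 1) (by simpa using hM)
  simpa using this

theorem stepsClip_le (hd : 1 ≤ d) (hM : 1 ≤ M) :
    (stepsClip d M : ℝ) ≤ 3 + 4 * Real.log M + Real.log d := by
  have hd' : (1 : ℝ) ≤ d := by exact_mod_cast hd
  have hs : 1 ≤ √(d : ℝ) := Real.one_le_sqrt.2 hd'
  have e : clipRange d M / (1 / M) = 2 * M ^ 2 * √d := by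
    have : M ≠ 0 := by linarith
    unfold clipRange; field_simp
  have h1 : 1 ≤ 2 * M ^ 2 * √d := by
    have : 1 ≤ M ^ 2 := one_le_pow₀ hM
    nlinarith
  have h := searchSteps_le (R := clipRange d M) (τ := 1 / M) (by rwa [e])
  rw [e, Real.log_mul (by positivity) (by positivity), Real.log_mul (by norm_num) (by positivity),
    Real.log_pow, Real.log_sqrt (by positivity)] at h
  have h2 := Real.log_two_lt_d9
  push_cast at h
  linarith

theorem exp_neg_logFactor (hd : 1 ≤ d) (hM : 1 ≤ M) (hβ : 0 < β) :
    Real.exp (-logFactor d M β) = Real.exp (-1) * (β / (d * M)) := by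
  have hd' : (0 : ℝ) < d := by exact_mod_cast hd
  have hM' : 0 < M := by linarith
  have e : -logFactor d M β = -1 + Real.log (β / (d * M)) := by
    unfold logFactor
    rw [Real.log_div hβ.ne' (by positivity), Real.log_mul hd'.ne' hM'.ne', one_div, Real.log_inv]
    ring
  rw [e, Real.exp_add, Real.exp_log (by positivity)]

theorem exp_neg_eight_logFactor_le (hd : 1 ≤ d) (hM : 1 ≤ M) (hβ : 0 < β) (hβ1 : β < 1) :
    Real.exp (-(8 * logFactor d M β)) ≤ β / (d * M) / 256 := by
  have hd' : (1 : ℝ) ≤ d := by exact_mod_cast hd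
  set q := β / (d * M) with hq
  have hdM : 1 ≤ d * M := by nlinarith
  have hq0 : 0 < q := by positivity
  have hq1 : q ≤ 1 := by rw [hq, div_le_one (by linarith)]; linarith
  have e : Real.exp (-(8 * logFactor d M β)) = Real.exp (-1) ^ 8 * q ^ 8 := by
    rw [← mul_pow, hq, ← exp_neg_logFactor hd hM hβ, ← Real.exp_nat_mul]
    congr 1; push_cast; ring
  have h1 : Real.exp (-1) ≤ 1 / 2 := by
    rw [Real.exp_neg, inv_eq_one_div]
    have := Real.add_one_le_exp (1 : ℝ)
    exact one_div_le_one_div_of_le (by norm_num) (by linarith)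
  have h2 : Real.exp (-1) ^ 8 ≤ (1 / 2) ^ 8 := by gcongr
  have h3 : q ^ 8 ≤ q := pow_le_of_le_one hq0.le hq1 (by norm_num)
  rw [e]
  calc Real.exp (-1) ^ 8 * q ^ 8 ≤ (1 / 2) ^ 8 * q := by gcongr
    _ = q / 256 := by ring

/-- A polylogarithmic multiple of the standard deviation beats the concentration bound. -/
theorem exists_concentration_scale {A : ℝ} (hA : 0 < A) (a : ℕ) :
    ∃ K : ℝ, 1 < K ∧ ∀ w l : ℝ, 1 ≤ w → 0 ≤ l → 1 + l ≤ w →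
      A * Real.exp (-(K * w ^ (a + 1) / (A * (1 + l + Real.log (K * w ^ (a + 1))) ^ a))) ≤
        Real.exp (-w) / 16 := by
  have hlim := Real.tendsto_pow_mul_exp_neg_atTop_nhds_zero a
  have hε : 0 < Real.exp (-(a + 2)) / (A * (1 + 16 * A)) := by positivity
  obtain ⟨v, hv1, hv2⟩ := ((hlim.eventually_lt_const hε).and
    (Filter.eventually_gt_atTop ((a : ℝ) + 2))).exists
  -- With this `K`, the estimates `1 + l ≤ w` and `log w ≤ w` give `1 + l + log (K w^(a+1)) ≤ v w`.
  -- Since `K` is exponential in `v`, a large `v` ensures `K ≥ A (1 + 16 A) v^a`. The exponent is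
  -- then at least `w + 16 A`, and `exp (16 A) ≥ 16 A` absorbs the prefactor `A`.
  set K := Real.exp (v - (a + 2)) with hK
  have hK1 : 1 < K := Real.one_lt_exp_iff.2 (by linarith)
  have hKv : A * (1 + 16 * A) * v ^ a ≤ K := by
    rw [lt_div_iff₀ (by positivity)] at hv1
    have e1 : K = Real.exp v * Real.exp (-(a + 2)) := by rw [hK, ← Real.exp_add]; congr 1
    have e2 : Real.exp v * Real.exp (-v) = 1 := by rw [← Real.exp_add]; simp
    rw [e1]
    calc A * (1 + 16 * A) * v ^ a
        = Real.exp v * (v ^ a * Real.exp (-v) * (A * (1 + 16 * A))) := by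
          linear_combination (-(A * (1 + 16 * A) * v ^ a)) * e2
      _ ≤ _ := by gcongr
  refine ⟨K, hK1, fun w l hw hl hlw => ?_⟩
  have hw0 : 0 < w := by linarith
  have hK0 : 0 < K := by linarith
  have hlogt : Real.log (K * w ^ (a + 1)) = (v - (a + 2)) + (a + 1) * Real.log w := by
    rw [Real.log_mul hK0.ne' (by positivity), Real.log_pow, hK, Real.log_exp]
    push_cast; ring
  have hlogw : Real.log w ≤ w := (Real.log_le_sub_one_of_pos hw0).trans (by linarith)
  have hlogw0 : 0 ≤ Real.log w := Real.log_nonneg hw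
  have hY : 1 + l + Real.log (K * w ^ (a + 1)) ≤ v * w := by
    rw [hlogt]
    have h1 : (v - (a + 2)) * 1 ≤ (v - (a + 2)) * w :=
      mul_le_mul_of_nonneg_left hw (by linarith)
    have h2 : ((a : ℝ) + 1) * Real.log w ≤ (a + 1) * w := by gcongr
    nlinarith
  have hY0 : 0 < 1 + l + Real.log (K * w ^ (a + 1)) := by
    rw [hlogt]
    have : 0 ≤ ((a : ℝ) + 1) * Real.log w := by positivity
    linarith
  have hX : w + 16 * A ≤
      K * w ^ (a + 1) / (A * (1 + l + Real.log (K * w ^ (a + 1))) ^ a) := by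
    rw [le_div_iff₀ (by positivity)]
    calc (w + 16 * A) * (A * (1 + l + Real.log (K * w ^ (a + 1))) ^ a)
        ≤ ((1 + 16 * A) * w) * (A * (v * w) ^ a) := by
          gcongr
          nlinarith
      _ = (A * (1 + 16 * A) * v ^ a) * w ^ (a + 1) := by rw [mul_pow]; ring
      _ ≤ K * w ^ (a + 1) := by gcongr
  have h16 : 16 * A ≤ Real.exp (16 * A) := by linarith [Real.add_one_le_exp (16 * A)]
  calc A * Real.exp (-(K * w ^ (a + 1) / (A * (1 + l + Real.log (K * w ^ (a + 1))) ^ a)))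
      ≤ A * Real.exp (-(w + 16 * A)) := by gcongr
    _ = A * (Real.exp (-w) / Real.exp (16 * A)) := by
        rw [← Real.exp_sub]; congr 2; ring
    _ ≤ A * (Real.exp (-w) / (16 * A)) := by gcongr
    _ = Real.exp (-w) / 16 := by field_simp

theorem median_noise_le (hd : 1 ≤ d) (hM : 1 ≤ M) (hβ : 0 < β) (hβ1 : β < 1) (hρ : 0 < ρ) :
    √((stepsMedian M : ℕ) / (2 * (ρ / 3 / d))) * (4 * logFactor d M β) ≤
      8 * logFactor d M β ^ 2 * √(d / ρ) := by
  obtain ⟨h1, h2, h3, hl⟩ := logFactor_bounds hd hM hβ hβ1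
  have hd' : (0 : ℝ) < d := by exact_mod_cast hd
  set ℓ := logFactor d M β with hℓ
  have hT : (stepsMedian M : ℝ) ≤ 2 * ℓ := by
    have := stepsMedian_le hM
    rw [hℓ, logFactor]; linarith
  have h : √((stepsMedian M : ℕ) / (2 * (ρ / 3 / d))) ≤ 2 * ℓ * √(d / ρ) := by
    refine Real.sqrt_le_iff.2 ⟨by positivity, ?_⟩
    rw [mul_pow, Real.sq_sqrt (by positivity)]
    calc (stepsMedian M : ℝ) / (2 * (ρ / 3 / d)) ≤ 2 * ℓ / (2 * (ρ / 3 / d)) := by gcongr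
      _ = 3 * ℓ * (d / ρ) := by field_simp
      _ ≤ (2 * ℓ) ^ 2 * (d / ρ) := by gcongr; nlinarith
  calc _ ≤ 2 * ℓ * √(d / ρ) * (4 * ℓ) := by gcongr
    _ = _ := by ring

theorem clip_noise_le (hd : 1 ≤ d) (hM : 1 ≤ M) (hβ : 0 < β) (hβ1 : β < 1) (hρ : 0 < ρ) :
    √((stepsClip d M : ℕ) / (2 * (ρ / 3))) * (4 * logFactor d M β) ≤
      12 * logFactor d M β ^ 2 * √(1 / ρ) := by
  obtain ⟨h1, h2, h3, hl⟩ := logFactor_bounds hd hM hβ hβ1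
  set ℓ := logFactor d M β with hℓ
  have hT : (stepsClip d M : ℝ) ≤ 4 * ℓ := by
    have := stepsClip_le hd hM
    rw [hℓ, logFactor]; linarith
  have h : √((stepsClip d M : ℕ) / (2 * (ρ / 3))) ≤ 3 * ℓ * √(1 / ρ) := by
    refine Real.sqrt_le_iff.2 ⟨by positivity, ?_⟩
    rw [mul_pow, Real.sq_sqrt (by positivity)]
    calc (stepsClip d M : ℝ) / (2 * (ρ / 3)) ≤ 4 * ℓ / (2 * (ρ / 3)) := by gcongr
      _ = 6 * ℓ * (1 / ρ) := by field_simp; norm_num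
      _ ≤ (3 * ℓ) ^ 2 * (1 / ρ) := by gcongr; nlinarith
  calc _ ≤ 3 * ℓ * √(1 / ρ) * (4 * ℓ) := by gcongr
    _ = _ := by ring

theorem noise_probability_le (hd : 1 ≤ d) (hM : 1 ≤ M) (hβ : 0 < β) (hβ1 : β < 1) :
    (noiseLaw d (stepsMedian M) (stepsClip d M)).real
      {ω | ¬ NoiseBounded (4 * logFactor d M β) ω} ≤ β / 8 := by
  obtain ⟨h1, h2, h3, hl⟩ := logFactor_bounds hd hM hβ hβ1
  have hd' : (1 : ℝ) ≤ d := by exact_mod_cast hd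
  refine (noiseLaw_not_noiseBounded_le d _ _ (by linarith)).trans ?_
  have he : Real.exp (-((4 * logFactor d M β) ^ 2 / 2)) ≤ β / (d * M) / 256 := by
    refine le_trans (Real.exp_le_exp.2 ?_) (exp_neg_eight_logFactor_le hd hM hβ hβ1)
    nlinarith
  have hlM : Real.log M ≤ M := (Real.log_le_sub_one_of_pos (by linarith)).trans (by linarith)
  have hld : Real.log d ≤ d := (Real.log_le_sub_one_of_pos (by linarith)).trans (by linarith)
  have hT1 : (stepsMedian M : ℝ) ≤ 3 * M := by linarith [stepsMedian_le hM]
  have hT2 : (stepsClip d M : ℝ) ≤ 8 * (d * M) := by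
    have := stepsClip_le hd hM
    nlinarith
  -- The factor `1 / (d M)` in `exp (-8ℓ)` pays for the union bound over all noise variables.
  have hsum : (d * stepsMedian M + stepsClip d M + d : ℝ) ≤ 12 * (d * M) := by
    have : (d * stepsMedian M : ℝ) ≤ d * (3 * M) := by gcongr
    nlinarith
  have hdM : 0 < d * M := by positivity
  calc (d * stepsMedian M + stepsClip d M + d : ℝ) *
        (2 * Real.exp (-((4 * logFactor d M β) ^ 2 / 2)))
      ≤ 12 * (d * M) * (2 * (β / (d * M) / 256)) := by gcongr
    _ = 24 / 256 * β := by field_simp; norm_num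
    _ ≤ β / 8 := by linarith

end

section

/-! ### Accuracy for a general target rank -/

variable {d n : ℕ} {D : Measure (EuclideanSpace ℝ (Fin d))} [IsProbabilityMeasure D]
  {σhat : Fin d → ℝ} {M β ρ k K A : ℝ} {a : ℕ}

/-- The error bound of `norm_plan_sub_le` in terms of a polylogarithmic factor `w`. -/
theorem error_bound_le {n ℓ w t k ρ v l : ℝ} (hn : 0 < n) (hℓ : 1 ≤ ℓ) (hℓw : ℓ ≤ w) (ht : 1 ≤ t)
    (hρ : 0 < ρ) (hv : 0 ≤ v) (hvl : v ≤ l)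
    (hk : k ≤ √n + 24 * ℓ ^ 2 * √(1 / ρ)) :
    (2 * (√n * v) + 4 * ℓ * (2 * (√t * v) * √n) +
        (k + 12 * ℓ ^ 2 * √(1 / ρ)) * ((√t + 5) * v)) / n + 2 +
      √(8 * (2 * t + 50) * l / (ρ / 3)) / n * (√(2 * l) * (4 * ℓ)) ≤
    416 * (w ^ 2 * t) * (1 + v / √n + l / (n * √ρ)) := by
  have hw : 1 ≤ w := hℓ.trans hℓw
  have hl : 0 ≤ l := hv.trans hvl
  have hw2 : w ≤ w ^ 2 := by nlinarith
  have hℓ2 : ℓ ^ 2 ≤ w ^ 2 := by gcongr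
  have hst : √t ≤ t := by rw [Real.sqrt_le_left (by linarith)]; nlinarith
  have hsn : 0 < √n := Real.sqrt_pos.2 hn
  have hsn2 : √n / n = 1 / √n := by
    rw [div_eq_div_iff hn.ne' hsn.ne', one_mul, Real.mul_self_sqrt hn.le]
  have hsρ : 0 < √ρ := Real.sqrt_pos.2 hρ
  have hρinv : √(1 / ρ) = 1 / √ρ := by rw [Real.sqrt_div zero_le_one, Real.sqrt_one]
  set p := v / √n with hp
  set q := l / (n * √ρ) with hq
  have hp0 : 0 ≤ p := by positivity
  have hq0 : 0 ≤ q := by positivity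
  have hwt : 1 ≤ w ^ 2 * t := by nlinarith [one_le_pow₀ (n := 2) hw]
  have hnoise : √(8 * (2 * t + 50) * l / (ρ / 3)) / n * (√(2 * l) * (4 * ℓ)) ≤
      200 * (w ^ 2 * t) * q := by
    have h1 : √(8 * (2 * t + 50) * l / (ρ / 3)) * √(2 * l) ≤ 50 * t * l / √ρ := by
      rw [← Real.sqrt_mul (by positivity)]
      refine Real.sqrt_le_iff.2 ⟨by positivity, ?_⟩
      rw [div_pow, Real.sq_sqrt hρ.le]
      have e : 8 * (2 * t + 50) * l / (ρ / 3) * (2 * l) = (96 * t + 2400) * l ^ 2 / ρ := by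
        field_simp; ring
      rw [e, mul_pow]
      gcongr
      nlinarith
    calc _ = (√(8 * (2 * t + 50) * l / (ρ / 3)) * √(2 * l)) * (4 * ℓ) / n := by ring
      _ ≤ (50 * t * l / √ρ) * (4 * ℓ) / n := by gcongr
      _ = 200 * (ℓ * t) * q := by rw [hq]; field_simp; ring
      _ ≤ 200 * (w ^ 2 * t) * q := by gcongr; linarith
  have hmain : (2 * (√n * v) + 4 * ℓ * (2 * (√t * v) * √n) +
        (k + 12 * ℓ ^ 2 * √(1 / ρ)) * ((√t + 5) * v)) / n ≤
      16 * (w ^ 2 * t) * p + 216 * (w ^ 2 * t) * q := by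
    have h1 : (k + 12 * ℓ ^ 2 * √(1 / ρ)) * ((√t + 5) * v) ≤
        (√n + 36 * w ^ 2 * √(1 / ρ)) * (6 * t * v) := by
      have h2 : k + 12 * ℓ ^ 2 * √(1 / ρ) ≤ √n + 36 * w ^ 2 * √(1 / ρ) := by
        have : ℓ ^ 2 * √(1 / ρ) ≤ w ^ 2 * √(1 / ρ) := by gcongr
        linarith
      have h3 : √t + 5 ≤ 6 * t := by linarith
      calc _ ≤ (√n + 36 * w ^ 2 * √(1 / ρ)) * ((√t + 5) * v) := by gcongr
        _ ≤ _ := by gcongr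
    have h4 : 2 * (√n * v) + 4 * ℓ * (2 * (√t * v) * √n) ≤ 10 * (w ^ 2 * t) * (√n * v) := by
      have h5 : 2 + 8 * ℓ * √t ≤ 10 * (w ^ 2 * t) := by
        have : ℓ * √t ≤ w ^ 2 * t := mul_le_mul (by linarith) hst (Real.sqrt_nonneg _) (by positivity)
        nlinarith
      calc _ = (2 + 8 * ℓ * √t) * (√n * v) := by ring
        _ ≤ _ := by gcongr
    have h6 : √n * (6 * t * v) ≤ 6 * (w ^ 2 * t) * (√n * v) := by
      have : t ≤ w ^ 2 * t := le_mul_of_one_le_left (by linarith) (one_le_pow₀ hw)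
      calc √n * (6 * t * v) = 6 * t * (√n * v) := by ring
        _ ≤ _ := by gcongr
    -- The bias from the privacy noise in the rank is moved into the privacy term through `v ≤ l`,
    -- that is `‖σ‖₂ ≤ ‖σ‖₁`.
    have h7 : 36 * w ^ 2 * √(1 / ρ) * (6 * t * v) ≤ 216 * (w ^ 2 * t) * (l / √ρ) := by
      rw [hρinv]
      calc 36 * w ^ 2 * (1 / √ρ) * (6 * t * v) = 216 * (w ^ 2 * t) * (v / √ρ) := by ring
        _ ≤ _ := by gcongr
    calc _ ≤ (16 * (w ^ 2 * t) * (√n * v) + 216 * (w ^ 2 * t) * (l / √ρ)) / n := by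
          refine div_le_div_of_nonneg_right ?_ hn.le
          linarith
      _ = 16 * (w ^ 2 * t) * (v * (√n / n)) + 216 * (w ^ 2 * t) * q := by
          rw [hq]; field_simp
      _ = _ := by rw [hsn2, hp]; ring
  -- The coefficient of `q` is `216 + 200 = 416`; those of `p` and of the constant term are smaller.
  have h8 : 0 ≤ (w ^ 2 * t) * p := by positivity
  nlinarith

theorem planAccurate_of_rank (hK : 1 < K)
    (hconc : ∀ w l : ℝ, 1 ≤ w → 0 ≤ l → 1 + l ≤ w →
      A * Real.exp (-(K * w ^ (a + 1) / (A * (1 + l + Real.log (K * w ^ (a + 1))) ^ a))) ≤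
        Real.exp (-w) / 16)
    (hd : 1 ≤ d) (hρ : 0 < ρ) (hβ : 0 < β) (hβ1 : β < 1)
    (hM : ∀ᵐ x ∂D, ∀ i, |x i| ≤ M) (hσ : ∀ i, 1 ≤ sd D i) (hσhat : IsSdEstimate (sd D) σhat)
    (hD : WellConcentrated A a D)
    (hn : 145 * logFactor d M β ^ 4 * max 1 (√(d / ρ)) ≤ n)
    (hk₁ : 12 * logFactor d M β ^ 2 * √(1 / ρ) ≤ k)
    (hk₂ : k ≤ √n + 24 * logFactor d M β ^ 2 * √(1 / ρ)) :
    PlanAccurate n M k (ρ / 3) (ρ / 3) (ρ / 3) σhat D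
      (416 * K * (logFactor d M β + Real.log n) ^ (a + 3) *
        (1 + ‖sd D‖ / √n + l1Norm (sd D) / (n * √ρ))) β := by
  have hM0 : 0 ≤ M := by
    obtain ⟨x, hx⟩ := hM.exists
    exact (abs_nonneg _).trans (hx ⟨0, hd⟩)
  have hM1 : 1 ≤ M := (hσ ⟨0, hd⟩).trans (sd_le hM hM0 _)
  have hd' : (1 : ℝ) ≤ d := by exact_mod_cast hd
  obtain ⟨hld, hlM, hlβ, hℓ⟩ := logFactor_bounds hd hM1 hβ hβ1
  set ℓ := logFactor d M β with hℓdef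
  have hℓ2 : 1 ≤ ℓ ^ 2 := one_le_pow₀ hℓ
  have hℓ24 : ℓ ^ 2 ≤ ℓ ^ 4 := pow_le_pow_right₀ hℓ (by norm_num)
  have hℓ4 : ℓ ≤ ℓ ^ 4 := le_self_pow₀ hℓ (by norm_num)
  have hn1 : 145 * ℓ ^ 4 ≤ n := by
    refine le_trans ?_ hn
    exact le_mul_of_one_le_right (by positivity) (le_max_left _ _)
  have hn2 : 145 * ℓ ^ 2 * √(d / ρ) ≤ n := by
    refine le_trans ?_ hn
    gcongr
    exact le_max_right _ _
  have hnR : (145 : ℝ) ≤ n := by linarith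
  have hn0 : 0 < n := by
    have : (0 : ℝ) < n := by linarith
    exact_mod_cast this
  have hnpos : (0 : ℝ) < n := by linarith
  have hlogn : 0 ≤ Real.log n := Real.log_nonneg (by linarith)
  -- The summand `log n` pays for the union bound over the sample: `n exp (-w) = exp (-ℓ) ≤ β`.
  set w := ℓ + Real.log n with hw
  have hw1 : 1 ≤ w := by linarith
  set t := K * w ^ (a + 1) with ht
  have ht1 : 1 < t := by
    have : 1 ≤ w ^ (a + 1) := one_le_pow₀ hw1
    nlinarith
  set u := 4 * ℓ with hu
  have hδ : ∀ S : Set (EuclideanSpace ℝ (Fin d)),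
      D.real S ≤ A * Real.exp (-(t / (A * (1 + Real.log d + Real.log t) ^ a))) →
      D.real S ≤ Real.exp (-w) / 16 := fun S hS =>
    hS.trans (hconc w (Real.log d) hw1 hld (by rw [hw, hℓdef, logFactor]; linarith))
  obtain ⟨hc1, hc2⟩ := hD σhat hσhat t ht1
  have hnw : n * Real.exp (-w) ≤ β := by
    have e : n * Real.exp (-w) = Real.exp (-ℓ) := by
      rw [hw, neg_add, Real.exp_add, Real.exp_neg (Real.log n), Real.exp_log hnpos]
      field_simp
    rw [e]
    refine (Real.exp_le_exp.2 (?_ : -ℓ ≤ Real.log β)).trans_eq (Real.exp_log hβ)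
    rw [one_div, Real.log_inv] at hlβ
    rw [hℓdef, logFactor, one_div, Real.log_inv]
    linarith
  have hexp := exp_neg_eight_logFactor_le hd hM1 hβ hβ1
  rw [← hℓdef] at hexp
  have hdβ : d * (β / (d * M) / 256) ≤ β / 256 := by
    have e : d * (β / (d * M) / 256) = β / M / 256 := by field_simp
    rw [e]
    gcongr
    exact div_le_self hβ.le hM1
  have hbad : (Measure.pi fun _ : Fin n => D).real {x | ¬ TypicalSample D σhat M t
      (2 * (√n * ‖sd D‖) + u * (2 * (√t * ‖sd D‖) * √n)) x} ≤ β / 2 := by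
    refine (pi_not_typicalSample_le hn0 hd hM hσ (by linarith) (by linarith) (hδ _ hc1) (hδ _ hc2)
      (by linarith)).trans ?_
    have h1 : d * Real.exp (-((n : ℝ) / 8)) ≤ β / 256 := by
      refine le_trans ?_ hdβ
      gcongr
      exact (Real.exp_le_exp.2 (by linarith)).trans hexp
    have h2 : d * (8 * Real.exp (-(u ^ 2 / 2))) ≤ 8 * (β / 256) := by
      have h3 : d * Real.exp (-(u ^ 2 / 2)) ≤ β / 256 := by
        refine le_trans ?_ hdβ
        gcongr
        refine (Real.exp_le_exp.2 ?_).trans hexp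
        rw [hu]; nlinarith
      linarith
    linarith
  have hnoise := noise_probability_le hd hM1 hβ hβ1
  have hρd : √(1 / ρ) ≤ √(d / ρ) := by gcongr
  -- Since `145 ≥ 12²`. Together with `hsmall` this gives `k + N ≤ n/12 + 36 n/145 < n`.
  have hsqrt : √(n : ℝ) ≤ n / 12 := by
    refine Real.sqrt_le_iff.2 ⟨by positivity, ?_⟩
    nlinarith
  have hsmall : ℓ ^ 2 * √(1 / ρ) ≤ n / 145 := by
    have : ℓ ^ 2 * √(1 / ρ) ≤ ℓ ^ 2 * √(d / ρ) := by gcongr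
    linarith
  refine planAccurate_of_typical (t := t) (u := u) (N := 12 * ℓ ^ 2 * √(1 / ρ))
    (W := 2 * (√n * ‖sd D‖) + u * (2 * (√t * ‖sd D‖) * √n)) hn0 hd hM1 hM hσ hσhat (by linarith)
    (by positivity) (by linarith) ?_ (clip_noise_le hd hM1 hβ hβ1 hρ) (by positivity) hk₁
    (by linarith) (by positivity) (by linarith) ?_
  · refine (median_noise_le hd hM1 hβ hβ1 hρ).trans ?_
    rw [← hℓdef]
    linarith
  · have hfin := error_bound_le (n := n) (w := w) (t := t) hnpos hℓ (by linarith) ht1.le hρ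
      (norm_nonneg (sd D)) (norm_le_l1Norm (sd D)) hk₂
    have e : 416 * K * w ^ (a + 3) = 416 * (w ^ 2 * t) := by rw [ht]; ring
    rw [e]
    exact hfin

end

end PLAN

/-! ### Privacy and utility combined -/

theorem theorem4p2 :
    -- privacy, for every dataset
    (∀ (d n : ℕ) (M k ρ : ℝ) (σhat : Fin d → ℝ), 0 < ρ →
      PLAN.IsZCDP
        (fun x : Fin n → EuclideanSpace ℝ (Fin d) =>
          PLAN.planLaw M k (ρ / 3) (ρ / 3) (ρ / 3) σhat x) ρ) ∧
    -- utility
    (∃ (K₁ K₂ : ℝ) (b₁ b₂ : ℕ), 0 < K₁ ∧ 0 < K₂ ∧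
      ∀ (A : ℝ) (a : ℕ), 0 < A → ∃ (K : ℝ) (b : ℕ), 0 < K ∧
        ∀ (d n : ℕ) (M ρ β : ℝ) (D : MeasureTheory.Measure (EuclideanSpace ℝ (Fin d)))
          (σhat : Fin d → ℝ),
          1 ≤ d → 0 < ρ → 0 < β → β < 1 →
          MeasureTheory.IsProbabilityMeasure D →
          (∀ᵐ x ∂D, ∀ i, |x i| ≤ M) →
          (∀ i, 1 ≤ PLAN.sd D i) →
          PLAN.IsSdEstimate (PLAN.sd D) σhat →
          PLAN.WellConcentrated A a D →
          K₁ * PLAN.logFactor d M β ^ b₁ * max 1 (√(d / ρ)) ≤ n →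
          -- `k = √n`, when moreover `n` is at least of order `1 / ρ`
          (K₁ * PLAN.logFactor d M β ^ b₁ * (1 / ρ) ≤ n →
            PLAN.PlanAccurate n M (√n) (ρ / 3) (ρ / 3) (ρ / 3) σhat D
              (K * (PLAN.logFactor d M β + Real.log n) ^ b *
                (1 + ‖PLAN.sd D‖ / √n + PLAN.l1Norm (PLAN.sd D) / (n * √ρ))) β) ∧
          -- `k = √n + κ √(1 / ρ₂)` with a polylogarithmic factor `κ`
          PLAN.PlanAccurate n M
              (√n + K₂ * PLAN.logFactor d M β ^ b₂ * √(1 / (ρ / 3)))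
              (ρ / 3) (ρ / 3) (ρ / 3) σhat D
            (K * (PLAN.logFactor d M β + Real.log n) ^ b *
              (1 + ‖PLAN.sd D‖ / √n + PLAN.l1Norm (PLAN.sd D) / (n * √ρ))) β) := by
  -- `12 ℓ² √(1/ρ)` bounds the noise in the search for the radius, and the target rank `k` has to
  -- dominate it.
  refine ⟨fun d n M k ρ σhat hρ => ?_, 145, 12, 4, 2, by norm_num, by norm_num,
    fun A a hA => ?_⟩
  · have h : 0 < ρ / 3 := by positivity
    have key := PLAN.isZCDP_planLaw (n := n) M k h h h σhat
    have e : ρ / 3 + (ρ / 3 + ρ / 3) = ρ := by ring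
    rwa [e] at key
  · obtain ⟨K, hK, hconc⟩ := PLAN.exists_concentration_scale hA a
    refine ⟨416 * K, a + 3, by positivity, ?_⟩
    intro d n M ρ β D σhat hd hρ hβ hβ1 hprob hM hσ hσhat hD hn
    refine ⟨fun hn' => ?_, ?_⟩
    · refine PLAN.planAccurate_of_rank hK hconc hd hρ hβ hβ1 hM hσ hσhat hD hn ?_
        (le_add_of_nonneg_right (by positivity))
      -- For `k = √n` the requirement `12 ℓ² √(1/ρ) ≤ k` becomes `144 ℓ⁴ / ρ ≤ n` after squaring,
      -- which the extra condition on `n` supplies.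
      refine Real.le_sqrt_of_sq_le (le_trans ?_ hn')
      rw [mul_pow, Real.sq_sqrt (by positivity), mul_pow, ← pow_mul]
      exact mul_le_mul_of_nonneg_right (mul_le_mul_of_nonneg_right (by norm_num)
        (Even.pow_nonneg ⟨2, rfl⟩ _))
        (by positivity)
    -- The budget `ρ₂ = ρ / 3` adds a factor `√3` between `1` and `2`, so `k - √n` lies between `12
    -- ℓ² √(1/ρ)` and `24 ℓ² √(1/ρ)`.
    · have hs : 12 * PLAN.logFactor d M β ^ 2 * √(1 / (ρ / 3)) =
          12 * PLAN.logFactor d M β ^ 2 * (√3 * √(1 / ρ)) := by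
        rw [← Real.sqrt_mul (by norm_num)]
        congr 2
        field_simp
      have h1 : 1 ≤ √(3 : ℝ) := Real.one_le_sqrt.2 (by norm_num)
      have h2 : √(3 : ℝ) ≤ 2 := Real.sqrt_le_iff.2 ⟨by norm_num, by norm_num⟩
      refine PLAN.planAccurate_of_rank hK hconc hd hρ hβ hβ1 hM hσ hσhat hD hn ?_ ?_ <;> rw [hs]
      · have h3 : √(1 / ρ) ≤ √3 * √(1 / ρ) := le_mul_of_one_le_left (Real.sqrt_nonneg _) h1
        have h4 : 12 * PLAN.logFactor d M β ^ 2 * √(1 / ρ) ≤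
            12 * PLAN.logFactor d M β ^ 2 * (√3 * √(1 / ρ)) := by gcongr
        linarith [Real.sqrt_nonneg (n : ℝ)]
      · have h5 : 12 * PLAN.logFactor d M β ^ 2 * (√3 * √(1 / ρ)) ≤
            12 * PLAN.logFactor d M β ^ 2 * (2 * √(1 / ρ)) := by gcongr
        linarith
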